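/- Let $A$ be a finite alphabet. For subsets $B_0,\dots,B_k\subseteq A$ and letters $a_1,\dots,a_k\in A$ $(k\ge 0)$, the product $B_0^*a_1B_1^*\cdots a_kB_k^*$ is called unambiguous if every word $w$ of this language has exactly one factorization $w=u_0a_1u_1\cdots a_ku_k$ with $u_i\in B_i^*$ for all $i$. An unambiguous language over $A$ is a finite disjoint union of unambiguous products. A language $L$ separates $L_1$ from $L_2$ if $L_1\subseteq L$ and $L_2\cap L=\varnothing$. It is decidable whether two regular languages can be separated by an unambiguous language: there is an algorithm which, given a finite alphabet $A$ and two nondeterministic finite automata over $A$ accepting languages $L_1$ and $L_2$, decides whether some unambiguous language over $A$ separates $L_1$ from $L_2$. -/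

import Mathlib

/-- A product `B₀* a₁ B₁* ⋯ aₖ Bₖ*` over the alphabet `α`: its size `k`, the subalphabets
`B₀, …, Bₖ` and the letters `a₁, …, aₖ`. -/
structure LanguageProduct (α : Type*) where
  /-- the size `k` of the product -/
  size : ℕ
  /-- the subalphabets `B₀, …, Bₖ` -/
  block : Fin (size + 1) → Set α
  /-- the letters `a₁, …, aₖ` -/
  letter : Fin size → α

namespace LanguageProduct

variable {α : Type*}

/-- The words `u₀, …, uₖ` form a factorization `w = u₀ a₁ u₁ ⋯ aₖ uₖ` with `uᵢ ∈ Bᵢ*`,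
i.e. one that witnesses the membership of `w` in the product. -/
def IsFactorization (P : LanguageProduct α) (w : List α) (u : Fin (P.size + 1) → List α) : Prop :=
  (∀ i, ∀ x ∈ u i, x ∈ P.block i) ∧
    w = u 0 ++ (List.ofFn fun i : Fin P.size => P.letter i :: u i.succ).flatten

/-- The language `B₀* a₁ B₁* ⋯ aₖ Bₖ*`. -/
def language (P : LanguageProduct α) : Language α :=
  {w | ∃ u, P.IsFactorization w u}

/-- Every word of the product has exactly one factorization witnessing its membership. -/
def IsUnambiguous (P : LanguageProduct α) : Prop :=
  ∀ w ∈ P.language, ∃! u, P.IsFactorization w u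

end LanguageProduct

/-- An unambiguous language is a finite disjoint union of unambiguous products. -/
def IsUnambiguousLanguage {α : Type*} (L : Language α) : Prop :=
  ∃ (n : ℕ) (P : Fin n → LanguageProduct α),
    (∀ i, (P i).IsUnambiguous) ∧
    (∀ i j, i ≠ j → ∀ w, ¬ (w ∈ (P i).language ∧ w ∈ (P j).language)) ∧
    ∀ w, w ∈ L ↔ ∃ i, w ∈ (P i).language

/-- `L` separates `L₁` from `L₂`: `L₁ ⊆ L` and `L₂ ∩ L = ∅`. -/
def Separates {α : Type*} (L L₁ L₂ : Language α) : Prop :=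
  (∀ w ∈ L₁, w ∈ L) ∧ ∀ w ∈ L₂, w ∉ L

/-- Some unambiguous language separates `L₁` from `L₂`. -/
def ULSeparable {α : Type*} (L₁ L₂ : Language α) : Prop :=
  ∃ L : Language α, IsUnambiguousLanguage L ∧ Separates L L₁ L₂

/-- A finite description `(n, I, F, δ)` of a nondeterministic finite automaton: the number `n` of
states, the list of initial states, the list of final states, and the list of transitions
`(p, a, q)`. States and letters are numbered from `0`; numbers out of range are ignored. -/
abbrev NFACode : Type := ℕ × List ℕ × List ℕ × List (ℕ × ℕ × ℕ)

namespace NFACode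

/-- The automaton over the alphabet `Fin m` that a code describes. -/
def toNFA (m : ℕ) (c : NFACode) : NFA (Fin m) (Fin c.1) where
  step p a := {q | ((p : ℕ), (a : ℕ), (q : ℕ)) ∈ c.2.2.2}
  start := {p | (p : ℕ) ∈ c.2.1}
  accept := {p | (p : ℕ) ∈ c.2.2.1}

/-- The language over the alphabet `Fin m` of the automaton that a code describes. -/
def language (m : ℕ) (c : NFACode) : Language (Fin m) := (c.toNFA m).accepts

/-- The languages described by codes are exactly the regular languages. -/
theorem isRegular_iff (m : ℕ) (L : Language (Fin m)) :
    L.IsRegular ↔ ∃ c : NFACode, NFACode.language m c = L := by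
  classical
  constructor
  · rintro ⟨σ, _, M, rfl⟩
    let e := Fintype.equivFin σ
    let N : NFA (Fin m) (Fin (Fintype.card σ)) := (DFA.reindex e M).toNFA
    have hN : N.accepts = M.accepts := by
      simp [N, DFA.toNFA_correct]
    let s : List (Fin (Fintype.card σ)) := (Finset.univ.filter fun p => p ∈ N.start).toList
    let f : List (Fin (Fintype.card σ)) := (Finset.univ.filter fun p => p ∈ N.accept).toList
    let d : List (Fin (Fintype.card σ) × Fin m × Fin (Fintype.card σ)) :=
      (Finset.univ.filter fun t => t.2.2 ∈ N.step t.1 t.2.1).toList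
    refine ⟨(Fintype.card σ, s.map (fun p => (p : ℕ)), f.map (fun p => (p : ℕ)),
      d.map (fun t => ((t.1 : ℕ), (t.2.1 : ℕ), (t.2.2 : ℕ)))), ?_⟩
    rw [← hN]
    refine congrArg NFA.accepts (?_ : _ = N)
    have h1 : ∀ p a q, q ∈ N.step p a ↔ ((p : ℕ), (a : ℕ), (q : ℕ)) ∈
        d.map (fun t => ((t.1 : ℕ), (t.2.1 : ℕ), (t.2.2 : ℕ))) := by
      intro p a q
      simp only [d, List.mem_map, Finset.mem_toList, Finset.mem_filter, Finset.mem_univ, true_and,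
        Prod.mk.injEq, Fin.val_inj]
      constructor
      · intro h
        exact ⟨(p, a, q), h, rfl, rfl, rfl⟩
      · rintro ⟨⟨p', a', q'⟩, h, rfl, rfl, rfl⟩
        exact h
    have h2 : ∀ p, p ∈ N.start ↔ (p : ℕ) ∈ s.map (fun p => (p : ℕ)) := by
      intro p
      simp [s, Fin.val_inj]
    have h3 : ∀ p, p ∈ N.accept ↔ (p : ℕ) ∈ f.map (fun p => (p : ℕ)) := by
      intro p
      simp [f, Fin.val_inj]
    have ext : ∀ N' : NFA (Fin m) (Fin (Fintype.card σ)), (∀ p a q, q ∈ N.step p a ↔ q ∈ N'.step p a) →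
        (∀ p, p ∈ N.start ↔ p ∈ N'.start) → (∀ p, p ∈ N.accept ↔ p ∈ N'.accept) → N' = N := by
      rintro ⟨st, i, ac⟩ h1 h2 h3
      rcases hh : N with ⟨st', i', ac'⟩
      rw [hh] at h1 h2 h3
      congr
      · funext p a; ext q; exact (h1 p a q).symm
      · ext p; exact (h2 p).symm
      · ext p; exact (h3 p).symm
    exact ext _ h1 h2 h3
  · rintro ⟨c, rfl⟩
    exact ⟨Set (Fin c.1), inferInstance, (c.toNFA m).toDFA, (c.toNFA m).toDFA_correct⟩

end NFACode

/-! Inseparability is characterized by a relation `Linked` between states of the product of the two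
automata, generated by finitely many rules. The decisive rule is `loop`: if `s` and `t` both carry
linked loops with letter set `B`, then they are linked as soon as words of `B*` lead from `s` to `t`
in each automaton, however different these words are.

Links obstruct separation. Every unambiguous language absorbs: between high powers of two words with
the same letters, a word over these letters can be exchanged for any other
(`UnambiguousProduct.exists_absorbs`). Otherwise a marker would be trapped in the middle, and
pumping what follows it would produce a word with two factorizations. By `Linked.exists_words`, a
link from initial to final states then yields accepted words, one of each automaton, that a given
unambiguous language cannot distinguish.

Conversely, `hasPartition_within_indist` cuts `B*` into finitely many disjoint unambiguous products
whose words are pairwise indistinguishable. The induction is on `B`: a word is cut after its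
shortest prefix, or before its shortest suffix, that contains all of `B`. Such cuts are unique, so
unambiguity survives. After more cuts on each side than there are pairs of states, the pigeonhole
principle finds linked loops on both sides, and `loop` links across the arbitrary middle. If no link
joins initial to final states, the classes that meet the first language form a separator.

Finally, links are found by saturating a finite set of facts: inseparability shows up in some round,
and separability shows up as a closed round without a refuting fact. -/

namespace UnambiguousSeparation

/-! ### Unambiguous products as an inductive family of languages -/

variable {α : Type*}

/-- The language `B*`. -/
def blockStar (B : Set α) : Set (List α) := {w | ∀ x ∈ w, x ∈ B}

/-- The language `K a L`. -/
def markedConcat (K : Set (List α)) (a : α) (L : Set (List α)) : Set (List α) :=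
  {w | ∃ u ∈ K, ∃ v ∈ L, w = u ++ a :: v}

/-- Every word of `K a L` has only one factorization. -/
def UniqueSplit (K : Set (List α)) (a : α) (L : Set (List α)) : Prop :=
  ∀ u ∈ K, ∀ u' ∈ K, ∀ v ∈ L, ∀ v' ∈ L, u ++ a :: v = u' ++ a :: v' → u = u'

theorem UniqueSplit.tail {K L : Set (List α)} {a : α} (h : UniqueSplit K a L) {u u' v v' : List α}
    (hu : u ∈ K) (hu' : u' ∈ K) (hv : v ∈ L) (hv' : v' ∈ L)
    (e : u ++ a :: v = u' ++ a :: v') : v = v' := by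
  obtain rfl := h u hu u' hu' v hv v' hv' e
  simpa using e

/-- The languages of unambiguous products, generated from the left. -/
inductive UnambiguousProduct : Set (List α) → Prop
  | block (B : Set α) : UnambiguousProduct (blockStar B)
  | cons (B : Set α) (a : α) (L : Set (List α)) (hL : UnambiguousProduct L)
      (h : UniqueSplit (blockStar B) a L) : UnambiguousProduct (markedConcat (blockStar B) a L)

/-- Marked concatenation is associative, so the marker `b` can be pushed to the right until it meets
the last block of `K`. -/
theorem UnambiguousProduct.markedConcat {K L : Set (List α)} {b : α} (hK : UnambiguousProduct K)
    (hL : UnambiguousProduct L) (h : UniqueSplit K b L) :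
    UnambiguousProduct (markedConcat K b L) := by
  induction hK with
  | block B => exact .cons B b L hL h
  | cons B a K hK hs ih =>
    have e : UnambiguousSeparation.markedConcat
        (UnambiguousSeparation.markedConcat (blockStar B) a K) b L =
        UnambiguousSeparation.markedConcat (blockStar B) a
          (UnambiguousSeparation.markedConcat K b L) := by
      ext w
      constructor
      · rintro ⟨_, ⟨u, hu, v, hv, rfl⟩, z, hz, rfl⟩
        exact ⟨u, hu, _, ⟨v, hv, z, hz, rfl⟩, by simp⟩
      · rintro ⟨u, hu, _, ⟨v, hv, z, hz, rfl⟩, rfl⟩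
        exact ⟨_, ⟨u, hu, v, hv, rfl⟩, z, hz, by simp⟩
    rw [e]
    refine .cons B a _ (ih ?_) ?_
    · intro u hu u' hu' v hv v' hv' e
      -- The empty word lies in `B*`, so prefixing `a` turns two splits of the tail into two splits
      -- of the whole product.
      have := h (a :: u) ⟨[], by simp [blockStar], u, hu, rfl⟩ (a :: u')
        ⟨[], by simp [blockStar], u', hu', rfl⟩ v hv v' hv' (by simpa using e)
      simpa using this
    · rintro u hu u' hu' _ ⟨x, hx, y, hy, rfl⟩ _ ⟨x', hx', y', hy', rfl⟩ e
      have := h (u ++ a :: x) ⟨u, hu, x, hx, rfl⟩ (u' ++ a :: x')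
        ⟨u', hu', x', hx', rfl⟩ y hy y' hy' (by simpa using e)
      exact hs u hu u' hu' x hx x' hx' this

/-- The product with the single block `B`. -/
def singleBlock (B : Set α) : LanguageProduct α := ⟨0, fun _ => B, Fin.elim0⟩

/-- The product `B* a P`. -/
def consBlock (B : Set α) (a : α) (P : LanguageProduct α) : LanguageProduct α :=
  ⟨P.size + 1, Fin.cons B P.block, Fin.cons a P.letter⟩

theorem isFactorization_singleBlock {B : Set α} {w : List α} {u} :
    (singleBlock B).IsFactorization w u ↔ w = u 0 ∧ w ∈ blockStar B := by
  change ((∀ i : Fin 1, ∀ x ∈ u i, x ∈ B) ∧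
    w = u 0 ++ (List.ofFn fun i : Fin 0 => Fin.elim0 i :: u i.succ).flatten) ↔ _
  simp only [List.ofFn_zero, List.flatten_nil, List.append_nil, blockStar, Set.mem_ofPred_eq]
  constructor
  · rintro ⟨h, rfl⟩
    exact ⟨rfl, h 0⟩
  · rintro ⟨rfl, h⟩
    refine ⟨fun i => ?_, rfl⟩
    have : i = 0 := Subsingleton.elim _ _
    subst this
    exact h

theorem isFactorization_consBlock {B : Set α} {a : α} {P : LanguageProduct α} {w : List α}
    {u : Fin (P.size + 2) → List α} :
    (consBlock B a P).IsFactorization w u ↔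
      ∃ v, w = u 0 ++ a :: v ∧ u 0 ∈ blockStar B ∧ P.IsFactorization v (Fin.tail u) := by
  change ((∀ i : Fin (P.size + 2), ∀ x ∈ u i,
      x ∈ (Fin.cons B P.block : Fin (P.size + 2) → Set α) i) ∧
    w = u 0 ++ (List.ofFn fun i : Fin (P.size + 1) =>
      (Fin.cons a P.letter : Fin (P.size + 1) → α) i :: u i.succ).flatten) ↔ _
  rw [Fin.forall_fin_succ, List.ofFn_succ]
  simp only [Fin.cons_zero, Fin.cons_succ, List.flatten_cons]
  constructor
  · rintro ⟨⟨h0, h1⟩, rfl⟩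
    exact ⟨_, by simp; rfl, h0, h1, rfl⟩
  · rintro ⟨v, rfl, h0, h1, rfl⟩
    exact ⟨⟨h0, h1⟩, by simp [Fin.tail]⟩

theorem language_singleBlock (B : Set α) : (singleBlock B).language = blockStar B := by
  ext w
  constructor
  · rintro ⟨u, hu⟩
    exact (isFactorization_singleBlock.1 hu).2
  · intro h
    exact ⟨fun _ => w, isFactorization_singleBlock.2 ⟨rfl, h⟩⟩

theorem language_consBlock (B : Set α) (a : α) (P : LanguageProduct α) :
    (consBlock B a P).language = markedConcat (blockStar B) a P.language := by
  ext w
  constructor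
  · rintro ⟨u, hu⟩
    obtain ⟨v, rfl, h0, hv⟩ := isFactorization_consBlock.1 hu
    exact ⟨u 0, h0, v, ⟨_, hv⟩, rfl⟩
  · rintro ⟨u, hu, v, ⟨f, hf⟩, rfl⟩
    exact ⟨Fin.cons u f, isFactorization_consBlock.2 ⟨v, rfl, hu, hf⟩⟩

theorem isUnambiguous_singleBlock (B : Set α) : (singleBlock B).IsUnambiguous := by
  intro w hw
  rw [language_singleBlock] at hw
  refine ⟨fun _ => w, isFactorization_singleBlock.2 ⟨rfl, hw⟩, fun u hu => ?_⟩
  funext i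
  have : i = (0 : Fin 1) := Subsingleton.elim (α := Fin 1) _ _
  subst this
  exact (isFactorization_singleBlock.1 hu).1.symm

theorem isUnambiguous_consBlock {B : Set α} {a : α} {P : LanguageProduct α} :
    (consBlock B a P).IsUnambiguous ↔
      P.IsUnambiguous ∧ UniqueSplit (blockStar B) a P.language := by
  constructor
  · intro h
    constructor
    · rintro v ⟨f, hf⟩
      refine ⟨f, hf, fun g hg => ?_⟩
      have key : ∀ k, P.IsFactorization v k →
          (consBlock B a P).IsFactorization (a :: v) (Fin.cons [] k) := fun k hk =>
        isFactorization_consBlock.2 ⟨v, rfl, fun _ h => absurd h List.not_mem_nil, hk⟩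
      have := (h (a :: v) ⟨_, key f hf⟩).unique (key g hg) (key f hf)
      exact Fin.cons_right_injective (α := fun _ => List α) _ this
    · rintro u hu u' hu' v ⟨f, hf⟩ v' ⟨f', hf'⟩ e
      have k1 : (consBlock B a P).IsFactorization (u ++ a :: v) (Fin.cons u f) :=
        isFactorization_consBlock.2 ⟨v, rfl, hu, hf⟩
      have k2 : (consBlock B a P).IsFactorization (u ++ a :: v) (Fin.cons u' f') := by
        rw [e]
        exact isFactorization_consBlock.2 ⟨v', rfl, hu', hf'⟩
      have := (h (u ++ a :: v) ⟨_, k1⟩).unique k1 k2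
      exact congrFun this 0
  · rintro ⟨h, hs⟩ w ⟨u, hu⟩
    refine ⟨u, hu, fun u' hu' => ?_⟩
    obtain ⟨v, rfl, h0, hv⟩ := isFactorization_consBlock.1 hu
    obtain ⟨v', e, h0', hv'⟩ := isFactorization_consBlock.1 hu'
    have e0 := hs _ h0 _ h0' _ ⟨_, hv⟩ _ ⟨_, hv'⟩ e
    have e1 := hs.tail h0 h0' ⟨_, hv⟩ ⟨_, hv'⟩ e
    subst e1
    have e2 := (h v ⟨_, hv⟩).unique hv hv'
    have e3 := Fin.cons_self_tail (α := fun _ => List α) u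
    have e4 := Fin.cons_self_tail (α := fun _ => List α) u'
    exact e4.symm.trans ((congrArg₂ (fun x y => (Fin.cons x y : Fin (P.size + 2) → List α))
      e0.symm e2.symm).trans e3)

theorem unambiguousProduct_iff {L : Set (List α)} :
    UnambiguousProduct L ↔ ∃ P : LanguageProduct α, P.IsUnambiguous ∧ P.language = L := by
  constructor
  · intro h
    induction h with
    | block B => exact ⟨singleBlock B, isUnambiguous_singleBlock B, language_singleBlock B⟩
    | cons B a L _ hs ih =>
      obtain ⟨P, hP, rfl⟩ := ih
      exact ⟨consBlock B a P, isUnambiguous_consBlock.2 ⟨hP, hs⟩, language_consBlock B a P⟩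
  · rintro ⟨⟨k, block, letter⟩, hP, rfl⟩
    induction k with
    | zero =>
      have : (⟨0, block, letter⟩ : LanguageProduct α) = singleBlock (block 0) := by
        unfold singleBlock
        congr 1
        · funext i
          rw [Subsingleton.elim (α := Fin 1) i 0]
        · exact Subsingleton.elim _ _
      rw [this, language_singleBlock]
      exact .block _
    | succ k ih =>
      have e : (⟨k + 1, block, letter⟩ : LanguageProduct α) =
          consBlock (block 0) (letter 0) ⟨k, Fin.tail block, Fin.tail letter⟩ := by
        unfold consBlock
        congr 1
        · exact (Fin.cons_self_tail (α := fun _ => Set α) block).symm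
        · exact (Fin.cons_self_tail (α := fun _ => α) letter).symm
      rw [e] at hP ⊢
      rw [isUnambiguous_consBlock] at hP
      rw [language_consBlock]
      exact .cons _ _ _ (ih _ _ hP.1) hP.2

end UnambiguousSeparation

/-! ### Pumping and absorption -/

namespace UnambiguousSeparation

variable {α : Type*}

/-- The word `uⁿ`. -/
def wordPow (u : List α) (n : ℕ) : List α := (List.replicate n u).flatten

theorem wordPow_zero (u : List α) : wordPow u 0 = [] := rfl

theorem wordPow_succ (u : List α) (n : ℕ) : wordPow u (n + 1) = u ++ wordPow u n := by
  simp [wordPow, List.replicate_succ]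

theorem wordPow_add (u : List α) (m n : ℕ) : wordPow u (m + n) = wordPow u m ++ wordPow u n := by
  rw [wordPow, List.replicate_add, List.flatten_append]
  rfl

theorem mem_of_mem_wordPow {u : List α} {n : ℕ} {c : α} (h : c ∈ wordPow u n) : c ∈ u := by
  simp only [wordPow, List.mem_flatten, List.mem_replicate] at h
  obtain ⟨l, ⟨_, rfl⟩, hc⟩ := h
  exact hc

theorem mem_wordPow {u : List α} {n : ℕ} (hn : 1 ≤ n) {c : α} : c ∈ wordPow u n ↔ c ∈ u := by
  refine ⟨mem_of_mem_wordPow, fun h => ?_⟩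
  obtain ⟨n, rfl⟩ := Nat.exists_eq_add_of_le' hn
  rw [wordPow_succ]
  exact List.mem_append_left _ h

theorem append_mem_blockStar {B : Set α} {u v : List α} :
    u ++ v ∈ blockStar B ↔ u ∈ blockStar B ∧ v ∈ blockStar B := by
  simp only [blockStar, Set.mem_ofPred_eq, List.mem_append]
  exact ⟨fun h => ⟨fun x hx => h x (.inl hx), fun x hx => h x (.inr hx)⟩,
    fun h x hx => hx.elim (h.1 x) (h.2 x)⟩

theorem blockStar_of_subset {B : Set α} {u v : List α} (hu : u ∈ blockStar B) (h : v ⊆ u) :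
    v ∈ blockStar B :=
  fun x hx => hu x (h hx)

theorem append_eq_append_cons_iff {x z s r : List α} {a : α} :
    x ++ z = s ++ a :: r ↔
      (∃ c, x = s ++ a :: c ∧ r = c ++ z) ∨ ∃ c, s = x ++ c ∧ z = c ++ a :: r := by
  rw [List.append_eq_append_iff]
  constructor
  · rintro (⟨c, rfl, rfl⟩ | ⟨c, rfl, e⟩)
    · exact .inr ⟨c, rfl, rfl⟩
    · cases c with
      | nil => exact .inr ⟨[], by simp, by simpa using e.symm⟩
      | cons b c =>
        simp only [List.cons_append, List.cons.injEq] at e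
        obtain ⟨rfl, rfl⟩ := e
        exact .inl ⟨c, rfl, rfl⟩
  · rintro (⟨c, rfl, rfl⟩ | ⟨c, rfl, rfl⟩)
    · exact .inr ⟨a :: c, rfl, rfl⟩
    · exact .inl ⟨c, rfl, rfl⟩

/-- In a long power of `u`, some position lies inside a block that contains all letters of `u`. -/
theorem UnambiguousProduct.exists_pumping {L : Set (List α)} (hL : UnambiguousProduct L) :
    ∃ K, ∀ N, K ≤ N → ∀ u z y : List α, z ++ (wordPow u N ++ y) ∈ L →
      ∃ i j, i + j = N ∧
        ∀ t : List α, t ⊆ u → z ++ (wordPow u i ++ (t ++ (wordPow u j ++ y))) ∈ L := by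
  induction hL with
  | block B =>
    refine ⟨1, fun N hN u z y h => ⟨N, 0, rfl, fun t ht => ?_⟩⟩
    simp only [append_mem_blockStar] at h ⊢
    refine ⟨h.1, h.2.1, blockStar_of_subset h.2.1 fun c hc => (mem_wordPow hN).2 (ht hc), ?_, h.2.2⟩
    exact fun c hc => by simp [wordPow_zero] at hc
  | cons B a L _ _ ih =>
    obtain ⟨K, ih⟩ := ih
    refine ⟨K + 1, fun N hN u z y ⟨s, hs, r, hr, e⟩ => ?_⟩
    obtain ⟨M, rfl⟩ := Nat.exists_eq_add_of_le' (Nat.le_trans (Nat.le_add_left 1 K) hN)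
    rw [append_eq_append_cons_iff, wordPow_succ, List.append_assoc] at e
    rcases e with ⟨c, rfl, rfl⟩ | ⟨c, rfl, e⟩
    · rw [← List.append_assoc u, ← wordPow_succ] at hr
      obtain ⟨i, j, hij, h⟩ := ih (M + 1) (by omega) u c y hr
      exact ⟨i, j, hij, fun t ht => ⟨s, hs, _, h t ht, by simp⟩⟩
    · rw [append_eq_append_cons_iff] at e
      rcases e with ⟨d, rfl, rfl⟩ | ⟨d, rfl, e⟩
      · obtain ⟨i, j, hij, h⟩ := ih M (by omega) _ d y hr
        refine ⟨i + 1, j, by omega, fun t ht => ⟨z ++ c, hs, _, h t ht, ?_⟩⟩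
        simp [wordPow_succ]
      -- The marker comes after the first copy of `u`, so `B` contains all letters of `u` and `t`
      -- fits right behind that copy.
      · refine ⟨1, M, by omega, fun t ht => ⟨z ++ (u ++ (t ++ d)), ?_, r, hr, ?_⟩⟩
        · simp only [append_mem_blockStar] at hs ⊢
          exact ⟨hs.1, hs.2.1, blockStar_of_subset hs.2.1 ht, hs.2.2⟩
        · simp [wordPow_succ, wordPow_zero, e]

/-- `L` does not see what stands between large powers of two words with the same letters `B`,
as long as it is in `B*`. -/
def Absorbs (K : ℕ) (L : Set (List α)) : Prop :=
  ∀ M N, K ≤ M → K ≤ N → ∀ u v p q x y : List α, u ⊆ v → v ⊆ u → p ⊆ u → q ⊆ u →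
    x ++ (wordPow u M ++ (p ++ (wordPow v N ++ y))) ∈ L →
      x ++ (wordPow u M ++ (q ++ (wordPow v N ++ y))) ∈ L

theorem absorbs_univ : Absorbs 0 (Set.univ : Set (List α)) :=
  fun _ _ _ _ _ _ _ _ _ _ _ _ _ _ _ => trivial

/-- The position of the first marker `a` decides. If it lies in `x` or in the first copy of `u`, the
tail absorbs by induction. Otherwise `B` contains all letters of `u`; then `a` cannot lie before the
end of `p`, and if it lies later, `p` is inside the block `B*` and can be exchanged freely. -/
theorem UnambiguousProduct.exists_absorbs {L : Set (List α)} (hL : UnambiguousProduct L) :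
    ∃ K, Absorbs K L := by
  induction hL with
  | block B =>
    refine ⟨1, fun M N hM _ u v p q x y _ _ _ hq h => ?_⟩
    simp only [append_mem_blockStar] at h ⊢
    exact ⟨h.1, h.2.1, blockStar_of_subset h.2.1 fun c hc => (mem_wordPow hM).2 (hq hc), h.2.2.2⟩
  | cons B a L hL hsplit ih =>
    obtain ⟨K, ih⟩ := ih
    obtain ⟨K', hK'⟩ := hL.exists_pumping
    refine ⟨K + K' + 1, fun M' N hM' hN u v p q x y huv hvu hp hq ⟨s, hs, r, hr, e⟩ => ?_⟩
    obtain ⟨M, rfl⟩ := Nat.exists_eq_add_of_le' (Nat.le_trans (Nat.le_add_left 1 _) hM')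
    rw [append_eq_append_cons_iff] at e
    rcases e with ⟨c, rfl, rfl⟩ | ⟨c, rfl, e⟩
    · exact ⟨s, hs, _, ih _ N (by omega) (by omega) u v p q c y huv hvu hp hq hr, by simp⟩
    rw [wordPow_succ, List.append_assoc, append_eq_append_cons_iff] at e
    rcases e with ⟨d, rfl, rfl⟩ | ⟨d, rfl, e⟩
    · refine ⟨x ++ c, hs, _, ih M N (by omega) (by omega) _ v p q d y huv hvu hp hq hr, ?_⟩
      simp [wordPow_succ]
    rw [← List.append_assoc, append_eq_append_cons_iff] at e
    simp only [append_mem_blockStar] at hs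
    have hsub : ∀ t : List α, t ⊆ u → t ∈ blockStar B := fun t => blockStar_of_subset hs.2.1
    rcases e with ⟨f, e, rfl⟩ | ⟨f, rfl, e⟩
    -- The marker lies in `u^M p = d a f`. Pumping the tail `f v^N y` allows `d a f v^i` to be
    -- inserted after `f v^i`. The resulting word splits at both displayed occurrences of `a`,
    -- because everything before the second one uses only letters of `u`.
    · exfalso
      obtain ⟨i, j, rfl, h⟩ := hK' N (by omega) v f y hr
      have hin : d ++ a :: f ⊆ u := by
        rw [← e]
        exact List.append_subset.2 ⟨fun c hc => mem_of_mem_wordPow hc, hp⟩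
      have hv : wordPow v i ⊆ u := fun c hc => hvu (mem_of_mem_wordPow hc)
      have ht : (d ++ a :: f) ++ wordPow v i ⊆ v :=
        List.Subset.trans (List.append_subset.2 ⟨hin, hv⟩) huv
      have key := hsplit (x ++ (u ++ d)) (by simp only [append_mem_blockStar]; exact hs)
        (x ++ (u ++ (d ++ a :: f ++ (wordPow v i ++ d))))
        (by
          simp only [append_mem_blockStar]
          have := hsub _ hin
          rw [append_mem_blockStar] at this
          exact ⟨hs.1, hs.2.1, this, hsub _ hv, hs.2.2⟩)
        _ (h _ ht) _ hr (by simp [wordPow_add])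
      have := congrArg List.length key
      simp at this
    · refine ⟨x ++ (u ++ (wordPow u M ++ (q ++ f))), ?_, r, hr, ?_⟩
      · simp only [append_mem_blockStar] at hs ⊢
        exact ⟨hs.1, hs.2.1, hs.2.2.1.1, hsub q hq, hs.2.2.2⟩
      · simp [wordPow_succ, e]

theorem _root_.IsUnambiguousLanguage.exists_absorbs {L : Language α}
    (hL : IsUnambiguousLanguage L) : ∃ K, Absorbs K {w | w ∈ L} := by
  obtain ⟨n, P, hP, -, hmem⟩ := hL
  choose K hK using fun i => (unambiguousProduct_iff.2 ⟨P i, hP i, rfl⟩).exists_absorbs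
  refine ⟨∑ i, K i, fun M N hM hN u v p q x y huv hvu hp hq h => ?_⟩
  obtain ⟨i, hi⟩ := (hmem _).1 h
  have hle : K i ≤ ∑ i, K i := Finset.single_le_sum (fun _ _ => Nat.zero_le _) (Finset.mem_univ i)
  exact (hmem _).2 ⟨i, hK i M N (hle.trans hM) (hle.trans hN) u v p q x y huv hvu hp hq hi⟩

/-! ### Runs of nondeterministic automata -/

/-- The automaton `M` can read the word `w` from state `p` to state `q`. -/
def Reads {σ : Type*} (M : NFA α σ) (p : σ) (w : List α) (q : σ) : Prop := q ∈ M.evalFrom {p} w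

section Reads

variable {σ : Type*} {M : NFA α σ}

theorem reads_nil {p q : σ} : Reads M p [] q ↔ p = q := by
  simp [Reads, eq_comm]

theorem reads_singleton {p q : σ} {a : α} : Reads M p [a] q ↔ q ∈ M.step p a := by
  simp [Reads]

theorem reads_append {p q : σ} {u v : List α} :
    Reads M p (u ++ v) q ↔ ∃ r, Reads M p u r ∧ Reads M r v q := by
  unfold Reads
  rw [NFA.evalFrom_append, NFA.mem_evalFrom_iff_exists]

theorem reads_cons {p q : σ} {a : α} {v : List α} :
    Reads M p (a :: v) q ↔ ∃ r ∈ M.step p a, Reads M r v q := by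
  rw [← List.singleton_append, reads_append]
  simp only [reads_singleton]

theorem reads_wordPow {p : σ} {u : List α} (h : Reads M p u p) (n : ℕ) :
    Reads M p (wordPow u n) p := by
  induction n with
  | zero => exact reads_nil.2 rfl
  | succ n ih =>
    rw [wordPow_succ]
    exact reads_append.2 ⟨p, h, ih⟩

theorem mem_accepts_iff_reads {w : List α} :
    w ∈ M.accepts ↔ ∃ p ∈ M.start, ∃ q ∈ M.accept, Reads M p w q := by
  rw [NFA.mem_accepts]
  simp only [Reads]
  constructor
  · rintro ⟨q, hq, h⟩
    obtain ⟨p, hp, h⟩ := NFA.mem_evalFrom_iff_exists.1 h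
    exact ⟨p, hp, q, hq, h⟩
  · rintro ⟨p, hp, q, hq, h⟩
    exact ⟨q, hq, NFA.mem_evalFrom_iff_exists.2 ⟨p, hp, h⟩⟩

end Reads

/-! ### Links as an obstruction to separation -/

variable {σ₁ σ₂ : Type*} [DecidableEq α]

/-- The transitions of the two automata that no unambiguous language can tell apart: in
`Linked M₁ M₂ B (p₁, p₂) (q₁, q₂)`, both `p₁ → q₁` and `p₂ → q₂` read words with the letters `B`. -/
inductive Linked (M₁ : NFA α σ₁) (M₂ : NFA α σ₂) : Finset α → σ₁ × σ₂ → σ₁ × σ₂ → Prop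
  | nil (s : σ₁ × σ₂) : Linked M₁ M₂ ∅ s s
  | letter {s t : σ₁ × σ₂} {a : α} (h₁ : t.1 ∈ M₁.step s.1 a) (h₂ : t.2 ∈ M₂.step s.2 a) :
      Linked M₁ M₂ {a} s t
  | trans {B C : Finset α} {s t r : σ₁ × σ₂} (h : Linked M₁ M₂ B s t)
      (h' : Linked M₁ M₂ C t r) : Linked M₁ M₂ (B ∪ C) s r
  | loop {B : Finset α} {s t : σ₁ × σ₂} {x y : List α} (hs : Linked M₁ M₂ B s s)
      (ht : Linked M₁ M₂ B t t) (hx : x.toFinset ⊆ B) (hy : y.toFinset ⊆ B)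
      (hx' : Reads M₁ s.1 x t.1) (hy' : Reads M₂ s.2 y t.2) : Linked M₁ M₂ B s t

/-- Equivalence of the two words in every context is what makes the induction pass through
concatenations and powers. In the case `loop`, the loops are replaced power by power, and absorption
then exchanges the middles. -/
theorem Linked.exists_words {M₁ : NFA α σ₁} {M₂ : NFA α σ₂} {B : Finset α} {s t : σ₁ × σ₂}
    (h : Linked M₁ M₂ B s t) {K : ℕ} {L : Set (List α)} (hL : Absorbs K L) :
    ∃ u v : List α, u.toFinset = B ∧ v.toFinset = B ∧ Reads M₁ s.1 u t.1 ∧ Reads M₂ s.2 v t.2 ∧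
      ∀ x y, x ++ (u ++ y) ∈ L ↔ x ++ (v ++ y) ∈ L := by
  induction h with
  | nil s => exact ⟨[], [], rfl, rfl, reads_nil.2 rfl, reads_nil.2 rfl, fun _ _ => Iff.rfl⟩
  | @letter s t a h₁ h₂ =>
    exact ⟨[a], [a], rfl, rfl, reads_singleton.2 h₁, reads_singleton.2 h₂, fun _ _ => Iff.rfl⟩
  | @trans B C s t r _ _ ih ih' =>
    obtain ⟨u, v, rfl, hv, h₁, h₂, e⟩ := ih
    obtain ⟨u', v', rfl, hv', h₁', h₂', e'⟩ := ih'
    refine ⟨u ++ u', v ++ v', List.toFinset_append, by rw [List.toFinset_append, hv, hv'],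
      reads_append.2 ⟨_, h₁, h₁'⟩, reads_append.2 ⟨_, h₂, h₂'⟩, fun x y => ?_⟩
    have := e' (x ++ v) y
    simp only [List.append_assoc] at this ⊢
    rw [e, this]
  | @loop B s t p q _ _ hp hq hp' hq' ih ih' =>
    obtain ⟨u, u', hu, hu', h₁, h₂, e⟩ := ih
    obtain ⟨v, v', hv, hv', h₁', h₂', e'⟩ := ih'
    have powEquiv : ∀ {u u' : List α}, (∀ x y, x ++ (u ++ y) ∈ L ↔ x ++ (u' ++ y) ∈ L) →
        ∀ n x y, x ++ (wordPow u n ++ y) ∈ L ↔ x ++ (wordPow u' n ++ y) ∈ L := by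
      intro u u' e n
      induction n with
      | zero => exact fun _ _ => Iff.rfl
      | succ n ih =>
        intro x y
        have := ih (x ++ u') y
        simp only [List.append_assoc, wordPow_succ] at this ⊢
        rw [e, this]
    have content : ∀ {u v p : List α}, u.toFinset = B → v.toFinset = B → p.toFinset ⊆ B →
        (wordPow u (K + 1) ++ (p ++ wordPow v (K + 1))).toFinset = B := by
      intro u v p hu hv hp
      ext c
      have h1 : c ∈ u ↔ c ∈ B := by rw [← hu, List.mem_toFinset]
      have h2 : c ∈ v ↔ c ∈ B := by rw [← hv, List.mem_toFinset]
      have h3 : c ∈ p → c ∈ B := fun h => hp (List.mem_toFinset.2 h)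
      simp only [List.mem_toFinset, List.mem_append, mem_wordPow (Nat.le_add_left 1 K), h1, h2]
      tauto
    have mem {u : List α} (hu : u.toFinset = B) (c : α) : c ∈ u ↔ c ∈ B := by
      rw [← hu, List.mem_toFinset]
    -- The exponent `K + 1` is positive even for `K = 0`, so that all letters of `B` occur.
    refine ⟨wordPow u (K + 1) ++ (p ++ wordPow v (K + 1)),
      wordPow u' (K + 1) ++ (q ++ wordPow v' (K + 1)), content hu hv hp, content hu' hv' hq,
      reads_append.2 ⟨_, reads_wordPow h₁ _, reads_append.2 ⟨_, hp', reads_wordPow h₁' _⟩⟩,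
      reads_append.2 ⟨_, reads_wordPow h₂ _, reads_append.2 ⟨_, hq', reads_wordPow h₂' _⟩⟩,
      fun x y => ?_⟩
    have step : x ++ (wordPow u (K + 1) ++ (p ++ (wordPow v (K + 1) ++ y))) ∈ L ↔
        x ++ (wordPow u' (K + 1) ++ (p ++ (wordPow v' (K + 1) ++ y))) ∈ L := by
      rw [powEquiv e]
      have := powEquiv e' (K + 1) (x ++ (wordPow u' (K + 1) ++ p)) y
      simpa only [List.append_assoc] using this
    have huv : u' ⊆ v' := fun c hc => (mem hv' c).2 ((mem hu' c).1 hc)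
    have hvu : v' ⊆ u' := fun c hc => (mem hu' c).2 ((mem hv' c).1 hc)
    have hp1 : p ⊆ u' := fun c hc => (mem hu' c).2 (hp (List.mem_toFinset.2 hc))
    have hq1 : q ⊆ u' := fun c hc => (mem hu' c).2 (hq (List.mem_toFinset.2 hc))
    simp only [List.append_assoc]
    rw [step]
    exact ⟨hL _ _ (Nat.le_succ K) (Nat.le_succ K) u' v' p q x y huv hvu hp1 hq1,
      hL _ _ (Nat.le_succ K) (Nat.le_succ K) u' v' q p x y huv hvu hq1 hp1⟩

theorem not_ulSeparable_of_linked {M₁ : NFA α σ₁} {M₂ : NFA α σ₂} {B : Finset α}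
    {s t : σ₁ × σ₂} (h : Linked M₁ M₂ B s t) (hs₁ : s.1 ∈ M₁.start) (hs₂ : s.2 ∈ M₂.start)
    (ht₁ : t.1 ∈ M₁.accept) (ht₂ : t.2 ∈ M₂.accept) : ¬ ULSeparable M₁.accepts M₂.accepts := by
  rintro ⟨L, hL, h₁, h₂⟩
  obtain ⟨K, hK⟩ := hL.exists_absorbs
  obtain ⟨u, v, -, -, hu, hv, e⟩ := h.exists_words hK
  have := e [] []
  simp only [List.nil_append, List.append_nil] at this
  exact h₂ v (mem_accepts_iff_reads.2 ⟨_, hs₂, _, ht₂, hv⟩)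
    (this.1 (h₁ u (mem_accepts_iff_reads.2 ⟨_, hs₁, _, ht₁, hu⟩)))

end UnambiguousSeparation

/-! ### Finite partitions into unambiguous products -/

namespace UnambiguousSeparation

variable {α : Type*}

/-- `X` has a finite partition into unambiguous products such that words of the same product are
related by `R`. -/
def HasPartition (X : Set (List α)) (R : List α → List α → Prop) : Prop :=
  ∃ F : Set (Set (List α)), F.Finite ∧ (∀ L ∈ F, UnambiguousProduct L) ∧
    F.PairwiseDisjoint id ∧ ⋃₀ F = X ∧ ∀ L ∈ F, ∀ u ∈ L, ∀ v ∈ L, R u v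

namespace HasPartition

variable {X Y : Set (List α)} {R S T : List α → List α → Prop}

theorem mono (h : HasPartition X R) (hRS : ∀ u ∈ X, ∀ v ∈ X, R u v → S u v) :
    HasPartition X S := by
  obtain ⟨F, h1, h2, h3, rfl, h5⟩ := h
  exact ⟨F, h1, h2, h3, rfl, fun L hL u hu v hv =>
    hRS u ⟨L, hL, hu⟩ v ⟨L, hL, hv⟩ (h5 L hL u hu v hv)⟩

theorem block (B : Set α) (h : ∀ u ∈ blockStar B, ∀ v ∈ blockStar B, R u v) :
    HasPartition (blockStar B) R := by
  refine ⟨{blockStar B}, Set.finite_singleton _, ?_, Set.pairwiseDisjoint_singleton _ _,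
    Set.sUnion_singleton _, ?_⟩
  · rintro _ rfl
    exact .block B
  · rintro _ rfl
    exact h

theorem iUnion {ι : Type*} [Finite ι] {X : ι → Set (List α)}
    (hX : Pairwise fun i j => Disjoint (X i) (X j))
    (h : ∀ i, HasPartition (X i) R) : HasPartition (⋃ i, X i) R := by
  choose F h1 h2 h3 h4 h5 using h
  refine ⟨⋃ i, F i, Set.finite_iUnion h1, ?_, ?_, ?_, ?_⟩
  · intro L hL
    obtain ⟨i, hi⟩ := Set.mem_iUnion.1 hL
    exact h2 i L hi
  · intro L hL L' hL' hne
    obtain ⟨i, hi⟩ := Set.mem_iUnion.1 hL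
    obtain ⟨j, hj⟩ := Set.mem_iUnion.1 hL'
    by_cases hij : i = j
    · subst hij
      exact h3 i hi hj hne
    · exact (hX hij).mono (h4 i ▸ Set.subset_sUnion_of_mem hi) (h4 j ▸ Set.subset_sUnion_of_mem hj)
  · rw [Set.sUnion_iUnion]
    exact Set.iUnion_congr h4
  · intro L hL
    obtain ⟨i, hi⟩ := Set.mem_iUnion.1 hL
    exact h5 i L hi

theorem union (hXY : Disjoint X Y) (hX : HasPartition X R) (hY : HasPartition Y R) :
    HasPartition (X ∪ Y) R := by
  rw [Set.union_eq_iUnion]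
  refine iUnion ?_ ?_
  · rintro (_ | _) (_ | _) h
    · exact absurd rfl h
    · exact hXY.symm
    · exact hXY
    · exact absurd rfl h
  · rintro (_ | _)
    · exact hY
    · exact hX

/-- As `Y` is closed under `R`, each class lies inside `Y` or misses it; the classes that meet `Y`
are kept. -/
theorem inter (hX : HasPartition X R) (hY : ∀ u v, R u v → u ∈ Y → v ∈ Y) :
    HasPartition (X ∩ Y) R := by
  obtain ⟨F, h1, h2, h3, rfl, h5⟩ := hX
  refine ⟨{L ∈ F | ∃ w ∈ L, w ∈ Y}, h1.subset fun L hL => hL.1, fun L hL => h2 L hL.1,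
    h3.subset fun L hL => hL.1, ?_, fun L hL => h5 L hL.1⟩
  ext w
  constructor
  · rintro ⟨L, ⟨hL, u, hu, huY⟩, hw⟩
    exact ⟨⟨L, hL, hw⟩, hY u w (h5 L hL u hu w hw) huY⟩
  · rintro ⟨⟨L, hL, hw⟩, hwY⟩
    exact ⟨L, ⟨hL, w, hw, hwY⟩, hw⟩

/-- Uniqueness of the split serves twice: it keeps each product of classes unambiguous, and it makes
different products disjoint. -/
theorem markedConcat {a : α} (hX : HasPartition X R) (hY : HasPartition Y S)
    (hs : UniqueSplit X a Y)
    (hT : ∀ u ∈ X, ∀ u' ∈ X, ∀ v ∈ Y, ∀ v' ∈ Y, R u u' → S v v' → T (u ++ a :: v) (u' ++ a :: v')) :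
    HasPartition (markedConcat X a Y) T := by
  obtain ⟨F, f1, f2, f3, rfl, f5⟩ := hX
  obtain ⟨G, g1, g2, g3, rfl, g5⟩ := hY
  refine ⟨Set.image2 (fun K L => UnambiguousSeparation.markedConcat K a L) F G, f1.image2 _ g1,
    ?_, ?_, ?_, ?_⟩
  · rintro _ ⟨K, hK, L, hL, rfl⟩
    exact (f2 K hK).markedConcat (g2 L hL) fun u hu u' hu' v hv v' hv' =>
      hs u ⟨K, hK, hu⟩ u' ⟨K, hK, hu'⟩ v ⟨L, hL, hv⟩ v' ⟨L, hL, hv'⟩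
  · rintro _ ⟨K, hK, L, hL, rfl⟩ _ ⟨K', hK', L', hL', rfl⟩ hne
    refine Set.disjoint_left.2 ?_
    rintro w ⟨u, hu, v, hv, rfl⟩ ⟨u', hu', v', hv', e⟩
    have e1 := hs u ⟨K, hK, hu⟩ u' ⟨K', hK', hu'⟩ v ⟨L, hL, hv⟩ v' ⟨L', hL', hv'⟩ e
    have e2 := hs.tail ⟨K, hK, hu⟩ ⟨K', hK', hu'⟩ ⟨L, hL, hv⟩ ⟨L', hL', hv'⟩ e
    subst e1 e2
    obtain rfl : K = K' := f3.elim hK hK' (Set.not_disjoint_iff.2 ⟨u, hu, hu'⟩)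
    obtain rfl : L = L' := g3.elim hL hL' (Set.not_disjoint_iff.2 ⟨v, hv, hv'⟩)
    exact hne rfl
  · ext w
    constructor
    · rintro ⟨_, ⟨K, hK, L, hL, rfl⟩, u, hu, v, hv, rfl⟩
      exact ⟨u, ⟨K, hK, hu⟩, v, ⟨L, hL, hv⟩, rfl⟩
    · rintro ⟨u, ⟨K, hK, hu⟩, v, ⟨L, hL, hv⟩, rfl⟩
      exact ⟨_, ⟨K, hK, L, hL, rfl⟩, u, hu, v, hv, rfl⟩
  · rintro _ ⟨K, hK, L, hL, rfl⟩ _ ⟨u, hu, v, hv, rfl⟩ _ ⟨u', hu', v', hv', rfl⟩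
    exact hT u ⟨K, hK, hu⟩ u' ⟨K, hK, hu'⟩ v ⟨L, hL, hv⟩ v' ⟨L, hL, hv'⟩
      (f5 K hK u hu u' hu') (g5 L hL v hv v' hv')

end HasPartition

/-! ### Cutting words where their set of letters is completed -/

variable [DecidableEq α]

/-- The words whose set of letters is `B`. -/
def exactly (B : Finset α) : Set (List α) := {w | w.toFinset = B}

/-- The words whose set of letters is included in `B`. -/
def within (B : Finset α) : Set (List α) := {w | w.toFinset ⊆ B}

theorem within_eq_blockStar (B : Finset α) : within B = blockStar (B : Set α) := by
  ext w
  simp [within, blockStar, Finset.subset_iff]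

theorem exists_first_completion {B : Finset α} (hB : B.Nonempty) {w : List α}
    (hw : w.toFinset = B) :
    ∃ b ∈ B, ∃ u v, w = u ++ b :: v ∧ u.toFinset = B.erase b := by
  induction w using List.reverseRecOn with
  | nil =>
    subst hw
    simp at hB
  | append_singleton w c ih =>
    by_cases h : w.toFinset = B
    · obtain ⟨b, hb, u, v, rfl, hu⟩ := ih h
      exact ⟨b, hb, u, v ++ [c], by simp, hu⟩
    · rw [List.toFinset_append] at hw
      have hw' : insert c w.toFinset = B := by
        rw [← hw]
        ext x
        simp
      have hc : c ∉ w.toFinset := fun hc => h (by rw [← hw', Finset.insert_eq_of_mem hc])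
      exact ⟨c, hw' ▸ Finset.mem_insert_self _ _, w, [], rfl, by
        rw [← hw', Finset.erase_insert hc]⟩

theorem exists_last_completion {B : Finset α} (hB : B.Nonempty) {w : List α}
    (hw : w.toFinset = B) :
    ∃ b ∈ B, ∃ u v, w = u ++ b :: v ∧ v.toFinset = B.erase b := by
  obtain ⟨b, hb, u, v, e, hu⟩ := exists_first_completion hB (w := w.reverse) (by simpa using hw)
  refine ⟨b, hb, v.reverse, u.reverse, ?_, by simpa using hu⟩
  rw [← List.reverse_reverse w, e]
  simp

/-- If one prefix extended past the other cut, it would already contain all of `B`, including the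
letter that it must miss. -/
theorem first_completion_unique {B : Finset α} {b b' : α} (hb : b ∈ B) (hb' : b' ∈ B)
    {u v u' v' : List α} (hu : u.toFinset = B.erase b) (hu' : u'.toFinset = B.erase b')
    (e : u ++ b :: v = u' ++ b' :: v') : u = u' ∧ b = b' := by
  have aux : ∀ {b b' : α} {u u' c : List α}, b ∈ B → u.toFinset = B.erase b →
      u'.toFinset = B.erase b' → u ≠ u' ++ b' :: c := by
    rintro b b' u u' c hb hu hu' rfl
    have h1 : b ∉ (u' ++ b' :: c).toFinset := by simp [hu]
    simp only [List.toFinset_append, hu', List.toFinset_cons, Finset.mem_union, Finset.mem_erase,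
      Finset.mem_insert, hb] at h1
    tauto
  rw [append_eq_append_cons_iff] at e
  rcases e with ⟨c, h, -⟩ | ⟨c, h, e⟩
  · exact absurd h (aux hb hu hu')
  · cases c with
    | nil =>
      simp only [List.nil_append, List.cons.injEq] at e
      exact ⟨by simpa using h.symm, e.1⟩
    | cons d c =>
      simp only [List.cons_append, List.cons.injEq] at e
      rw [← e.1] at h
      exact absurd h (aux hb' hu' hu)

theorem last_completion_unique {B : Finset α} {b b' : α} (hb : b ∈ B) (hb' : b' ∈ B)
    {u v u' v' : List α} (hv : v.toFinset = B.erase b) (hv' : v'.toFinset = B.erase b')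
    (e : u ++ b :: v = u' ++ b' :: v') : v = v' ∧ b = b' := by
  have := first_completion_unique hb hb' (u := v.reverse) (u' := v'.reverse) (v := u.reverse)
    (v' := u'.reverse) (by simpa using hv) (by simpa using hv')
    (by simpa using congrArg List.reverse e)
  simpa using this

variable {R S T : List α → List α → Prop} {B : Finset α}

theorem HasPartition.ssubset (h : ∀ C ⊂ B, HasPartition (exactly C) R) :
    HasPartition {w | w.toFinset ⊂ B} R := by
  have e : {w : List α | w.toFinset ⊂ B} = ⋃ C : B.ssubsets, exactly (C : Finset α) := by
    ext w
    simp [exactly]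
  rw [e]
  refine .iUnion ?_ fun C => h C (Finset.mem_ssubsets.1 C.2)
  intro C C' hne
  refine Set.disjoint_left.2 fun w hw hw' => hne (Subtype.ext ?_)
  exact (show w.toFinset = C from hw).symm.trans hw'

/-- Refinement of a partition of `B*` by the first prefix that contains all letters of `B`. -/
theorem HasPartition.refine_left (hB : B.Nonempty)
    (h : ∀ C ⊂ B, HasPartition (exactly C) R) (hS : HasPartition (within B) S)
    (hRT : ∀ u v, R u v → T u v)
    (hT : ∀ b ∈ B, ∀ u u' v v', u.toFinset = B.erase b → u'.toFinset = B.erase b → R u u' →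
      S v v' → T (u ++ b :: v) (u' ++ b :: v')) :
    HasPartition (within B) T := by
  -- A word of `B*` either misses a letter of `B` or has a unique first completion `b`; these cases
  -- are disjoint.
  have e : within B = {w | w.toFinset ⊂ B} ∪
      ⋃ b : B, UnambiguousSeparation.markedConcat (exactly (B.erase b)) (b : α) (within B) := by
    ext w
    constructor
    · intro hw
      rcases eq_or_lt_of_le (show w.toFinset ≤ B from hw) with hw | hw
      · right
        obtain ⟨b, hb, u, v, rfl, hu⟩ := exists_first_completion hB hw
        refine Set.mem_iUnion.2 ⟨⟨b, hb⟩, u, hu, v, ?_, rfl⟩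
        intro c hc
        rw [← hw]
        simp only [List.mem_toFinset] at hc
        simp [hc]
      · exact .inl hw
    · rintro (hw | hw)
      · exact (Finset.ssubset_def.1 hw).1
      · obtain ⟨⟨b, hb⟩, u, hu, v, hv, rfl⟩ := Set.mem_iUnion.1 hw
        intro c hc
        have hu : u.toFinset = B.erase b := hu
        rw [List.toFinset_append, hu, List.toFinset_cons] at hc
        rcases Finset.mem_union.1 hc with hc | hc
        · exact Finset.mem_of_mem_erase hc
        · rcases Finset.mem_insert.1 hc with rfl | hc
          · exact hb
          · exact hv hc
  rw [e]
  refine .union ?_ ((HasPartition.ssubset h).mono fun u _ v _ => hRT u v) (.iUnion ?_ ?_)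
  · refine Set.disjoint_left.2 fun w hw hw' => ?_
    obtain ⟨⟨b, hb⟩, u, hu, v, hv, rfl⟩ := Set.mem_iUnion.1 hw'
    refine (Finset.ssubset_def.1 hw).2 fun c hc => ?_
    have hu : u.toFinset = B.erase b := hu
    rw [List.toFinset_append, hu, List.toFinset_cons]
    simp only [Finset.mem_union, Finset.mem_erase, Finset.mem_insert]
    tauto
  · rintro ⟨b, hb⟩ ⟨b', hb'⟩ hne
    refine Set.disjoint_left.2 ?_
    rintro _ ⟨u, hu, v, hv, rfl⟩ ⟨u', hu', v', hv', e⟩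
    exact hne (Subtype.ext (first_completion_unique hb hb' hu hu' e).2)
  · rintro ⟨b, hb⟩
    refine (h _ (Finset.erase_ssubset hb)).markedConcat hS ?_ ?_
    · exact fun u hu u' hu' v _ v' _ e => (first_completion_unique hb hb hu hu' e).1
    · exact fun u hu u' hu' v _ v' _ => hT b hb u u' v v' hu hu'

/-- Refinement of a partition of `B*` by the last suffix that contains all letters of `B`. -/
theorem HasPartition.refine_right (hB : B.Nonempty)
    (h : ∀ C ⊂ B, HasPartition (exactly C) R) (hS : HasPartition (within B) S)
    (hRT : ∀ u v, R u v → T u v)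
    (hT : ∀ b ∈ B, ∀ u u' v v', v.toFinset = B.erase b → v'.toFinset = B.erase b → S u u' →
      R v v' → T (u ++ b :: v) (u' ++ b :: v')) :
    HasPartition (within B) T := by
  have e : within B = {w | w.toFinset ⊂ B} ∪
      ⋃ b : B, UnambiguousSeparation.markedConcat (within B) (b : α) (exactly (B.erase b)) := by
    ext w
    constructor
    · intro hw
      rcases eq_or_lt_of_le (show w.toFinset ≤ B from hw) with hw | hw
      · right
        obtain ⟨b, hb, u, v, rfl, hv⟩ := exists_last_completion hB hw
        refine Set.mem_iUnion.2 ⟨⟨b, hb⟩, u, ?_, v, hv, rfl⟩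
        intro c hc
        rw [← hw]
        simp only [List.mem_toFinset] at hc
        simp [hc]
      · exact .inl hw
    · rintro (hw | hw)
      · exact (Finset.ssubset_def.1 hw).1
      · obtain ⟨⟨b, hb⟩, u, hu, v, hv, rfl⟩ := Set.mem_iUnion.1 hw
        intro c hc
        have hv : v.toFinset = B.erase b := hv
        rw [List.toFinset_append, List.toFinset_cons, hv] at hc
        rcases Finset.mem_union.1 hc with hc | hc
        · exact hu hc
        · rcases Finset.mem_insert.1 hc with rfl | hc
          · exact hb
          · exact Finset.mem_of_mem_erase hc
  rw [e]
  refine .union ?_ ((HasPartition.ssubset h).mono fun u _ v _ => hRT u v) (.iUnion ?_ ?_)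
  · refine Set.disjoint_left.2 fun w hw hw' => ?_
    obtain ⟨⟨b, hb⟩, u, hu, v, hv, rfl⟩ := Set.mem_iUnion.1 hw'
    refine (Finset.ssubset_def.1 hw).2 fun c hc => ?_
    have hv : v.toFinset = B.erase b := hv
    rw [List.toFinset_append, List.toFinset_cons, hv]
    simp only [Finset.mem_union, Finset.mem_erase, Finset.mem_insert]
    tauto
  · rintro ⟨b, hb⟩ ⟨b', hb'⟩ hne
    refine Set.disjoint_left.2 ?_
    rintro _ ⟨u, hu, v, hv, rfl⟩ ⟨u', hu', v', hv', e⟩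
    exact hne (Subtype.ext (last_completion_unique hb hb' hv hv' e).2)
  · rintro ⟨b, hb⟩
    refine hS.markedConcat (h _ (Finset.erase_ssubset hb)) ?_ ?_
    · intro u hu u' hu' v hv v' hv' e
      obtain rfl := (last_completion_unique hb hb hv hv' e).1
      simpa using e
    · exact fun u _ u' _ v hv v' hv' => hT b hb u u' v v' hv hv'

/-! ### Indistinguishable words and the construction of a separator -/

variable {σ₁ σ₂ : Type*} (M₁ : NFA α σ₁) (M₂ : NFA α σ₂)

/-- All transitions reading `u` in `M₁` and `v` in `M₂` are linked. -/
def Indist (u v : List α) : Prop :=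
  u.toFinset = v.toFinset ∧
    ∀ s t : σ₁ × σ₂, Reads M₁ s.1 u t.1 → Reads M₂ s.2 v t.2 → Linked M₁ M₂ u.toFinset s t

variable {M₁ M₂}

theorem Indist.append {u u' v v' : List α} (h : Indist M₁ M₂ u u') (h' : Indist M₁ M₂ v v') :
    Indist M₁ M₂ (u ++ v) (u' ++ v') := by
  refine ⟨by rw [List.toFinset_append, List.toFinset_append, h.1, h'.1], fun s t h₁ h₂ => ?_⟩
  obtain ⟨r₁, h₁, h₁'⟩ := reads_append.1 h₁
  obtain ⟨r₂, h₂, h₂'⟩ := reads_append.1 h₂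
  rw [List.toFinset_append]
  exact (h.2 s (r₁, r₂) h₁ h₂).trans (h'.2 (r₁, r₂) t h₁' h₂')

theorem indist_singleton (a : α) : Indist M₁ M₂ [a] [a] :=
  ⟨rfl, fun _ _ h₁ h₂ => .letter (reads_singleton.1 h₁) (reads_singleton.1 h₂)⟩

variable (M₁ M₂) in
/-- `u` and `v` split into `n` indistinguishable pieces whose set of letters is `B`. -/
def Chain (B : Finset α) : ℕ → List α → List α → Prop
  | 0, u, v => u = [] ∧ v = []
  | n + 1, u, v => ∃ x x' y y', Indist M₁ M₂ x x' ∧ x.toFinset = B ∧ Chain B n y y' ∧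
      u = x ++ y ∧ v = x' ++ y'

theorem Chain.snoc {n : ℕ} {u v x x' : List α} (h : Chain M₁ M₂ B n u v)
    (hx : Indist M₁ M₂ x x') (hB : x.toFinset = B) : Chain M₁ M₂ B (n + 1) (u ++ x) (v ++ x') := by
  induction n generalizing u v with
  | zero =>
    obtain ⟨rfl, rfl⟩ := h
    exact ⟨x, x', [], [], hx, hB, ⟨rfl, rfl⟩, by simp, by simp⟩
  | succ n ih =>
    obtain ⟨z, z', y, y', hz, hzB, hy, rfl, rfl⟩ := h
    exact ⟨z, z', _, _, hz, hzB, ih hy, by simp, by simp⟩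

theorem Chain.subset {n : ℕ} {u v : List α} (h : Chain M₁ M₂ B n u v) :
    u.toFinset ⊆ B ∧ v.toFinset ⊆ B := by
  induction n generalizing u v with
  | zero =>
    obtain ⟨rfl, rfl⟩ := h
    simp
  | succ n ih =>
    obtain ⟨x, x', y, y', hx, hB, hy, rfl, rfl⟩ := h
    rw [List.toFinset_append, List.toFinset_append, ← hx.1, hB]
    exact ⟨Finset.union_subset subset_rfl (ih hy).1, Finset.union_subset subset_rfl (ih hy).2⟩

theorem Chain.superset {n : ℕ} {u v : List α} (h : Chain M₁ M₂ B (n + 1) u v) :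
    B ⊆ u.toFinset ∧ B ⊆ v.toFinset := by
  obtain ⟨x, x', y, y', hx, hB, hy, rfl, rfl⟩ := h
  rw [List.toFinset_append, List.toFinset_append, ← hx.1, hB]
  exact ⟨Finset.subset_union_left, Finset.subset_union_left⟩

theorem Chain.exists_path {n : ℕ} {u v : List α} (h : Chain M₁ M₂ B n u v) {s t : σ₁ × σ₂}
    (h₁ : Reads M₁ s.1 u t.1) (h₂ : Reads M₂ s.2 v t.2) :
    ∃ f : ℕ → σ₁ × σ₂, f 0 = s ∧ f n = t ∧ ∀ i < n, Linked M₁ M₂ B (f i) (f (i + 1)) := by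
  induction n generalizing u v s with
  | zero =>
    obtain ⟨rfl, rfl⟩ := h
    exact ⟨fun _ => s, rfl, Prod.ext (reads_nil.1 h₁) (reads_nil.1 h₂), by simp⟩
  | succ n ih =>
    obtain ⟨x, x', y, y', hx, rfl, hy, rfl, rfl⟩ := h
    obtain ⟨r₁, h₁, h₁'⟩ := reads_append.1 h₁
    obtain ⟨r₂, h₂, h₂'⟩ := reads_append.1 h₂
    obtain ⟨f, f0, fn, hf⟩ := ih hy (s := (r₁, r₂)) h₁' h₂'
    refine ⟨fun i => Nat.casesOn i s f, rfl, fn, fun i hi => ?_⟩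
    cases i with
    | zero =>
      change Linked M₁ M₂ _ s (f 0)
      rw [f0]
      exact hx.2 _ _ h₁ h₂
    | succ i => exact hf i (Nat.lt_of_succ_lt_succ hi)

theorem linked_of_path {n : ℕ} {f : ℕ → σ₁ × σ₂}
    (hf : ∀ i < n, Linked M₁ M₂ B (f i) (f (i + 1))) {i k : ℕ} (h : i + k + 1 ≤ n) :
    Linked M₁ M₂ B (f i) (f (i + k + 1)) := by
  induction k with
  | zero => exact hf i (by omega)
  | succ k ih =>
    have := (ih (by omega)).trans (hf (i + k + 1) (by omega))
    rwa [Finset.union_self] at this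

theorem exists_linked_of_path {n : ℕ} {f : ℕ → σ₁ × σ₂}
    (hf : ∀ i < n, Linked M₁ M₂ B (f i) (f (i + 1))) {i j : ℕ} (hij : i ≤ j) (h : j ≤ n) :
    ∃ C ⊆ B, Linked M₁ M₂ C (f i) (f j) := by
  rcases hij.eq_or_lt with rfl | hij
  · exact ⟨∅, Finset.empty_subset _, .nil _⟩
  · obtain ⟨k, rfl⟩ := Nat.exists_eq_add_of_lt hij
    exact ⟨B, subset_rfl, linked_of_path hf h⟩

/-- The path through the chain visits `n + 1` pairs of states, so some pair repeats; the links
between two visits compose to a loop. -/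
theorem Chain.exists_loop [Finite σ₁] [Finite σ₂] {n : ℕ} (hn : Nat.card (σ₁ × σ₂) ≤ n)
    {u v : List α} (h : Chain M₁ M₂ B n u v) {s t : σ₁ × σ₂}
    (h₁ : Reads M₁ s.1 u t.1) (h₂ : Reads M₂ s.2 v t.2) :
    ∃ r, Linked M₁ M₂ B r r ∧ (∃ C ⊆ B, Linked M₁ M₂ C s r) ∧ ∃ C ⊆ B, Linked M₁ M₂ C r t := by
  obtain ⟨f, rfl, rfl, hf⟩ := h.exists_path h₁ h₂
  have := Fintype.ofFinite (σ₁ × σ₂)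
  obtain ⟨i, j, hne, e⟩ := Fintype.exists_ne_map_eq_of_card_lt (fun i : Fin (n + 1) => f i)
    (by rw [Fintype.card_fin, ← Nat.card_eq_fintype_card]; omega)
  wlog hij : i < j generalizing i j
  · exact this j i hne.symm e.symm (lt_of_le_of_ne (not_lt.1 hij) hne.symm)
  obtain ⟨k, hk⟩ := Nat.exists_eq_add_of_lt (Fin.lt_def.1 hij)
  refine ⟨f i, ?_, exists_linked_of_path hf (Nat.zero_le _) (Nat.lt_succ_iff.1 i.2),
    exists_linked_of_path hf (Nat.lt_succ_iff.1 i.2) le_rfl⟩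
  have := linked_of_path hf (i := i) (k := k) (by omega)
  rwa [← hk, ← show f i = f j from e] at this

variable (M₁ M₂) in
/-- `u` and `v` are indistinguishable, or have indistinguishable chains of `i` pieces at the left
and of `j` pieces at the right. -/
def Framed (B : Finset α) (i j : ℕ) (u v : List α) : Prop :=
  Indist M₁ M₂ u v ∨ ∃ x x' y y' z z', Chain M₁ M₂ B i x x' ∧ Chain M₁ M₂ B j z z' ∧
    y.toFinset ⊆ B ∧ y'.toFinset ⊆ B ∧ u = x ++ (y ++ z) ∧ v = x' ++ (y' ++ z')

/-- Each frame contains a linked loop with letters `B`, and the rule `loop` bridges everything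
between them. At least one piece per frame is needed for the letters to be exactly `B`. -/
theorem Framed.indist [Finite σ₁] [Finite σ₂] {n : ℕ} (hn : Nat.card (σ₁ × σ₂) ≤ n)
    {u v : List α} (h : Framed M₁ M₂ B (n + 1) (n + 1) u v) : Indist M₁ M₂ u v := by
  rcases h with h | ⟨x, x', y, y', z, z', hx, hz, hy, hy', rfl, rfl⟩
  · exact h
  have e : (x ++ (y ++ z)).toFinset = B := by
    simp only [List.toFinset_append]
    exact (Finset.union_subset hx.subset.1 (Finset.union_subset hy hz.subset.1)).antisymm
      (hx.superset.1.trans Finset.subset_union_left)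
  have e' : (x' ++ (y' ++ z')).toFinset = B := by
    simp only [List.toFinset_append]
    exact (Finset.union_subset hx.subset.2 (Finset.union_subset hy' hz.subset.2)).antisymm
      (hx.superset.2.trans Finset.subset_union_left)
  refine ⟨e.trans e'.symm, fun s t h₁ h₂ => ?_⟩
  rw [e]
  obtain ⟨p₁, h₁, h₁'⟩ := reads_append.1 h₁
  obtain ⟨q₁, h₁', h₁''⟩ := reads_append.1 h₁'
  obtain ⟨p₂, h₂, h₂'⟩ := reads_append.1 h₂
  obtain ⟨q₂, h₂', h₂''⟩ := reads_append.1 h₂'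
  obtain ⟨r, hr, ⟨C, hC, h⟩, D, hD, h'⟩ :=
    hx.exists_loop (s := s) (t := (p₁, p₂)) (Nat.le_succ_of_le hn) h₁ h₂
  obtain ⟨r', hr', ⟨D', hD', k⟩, C', hC', k'⟩ :=
    hz.exists_loop (s := (q₁, q₂)) (t := t) (Nat.le_succ_of_le hn) h₁'' h₂''
  -- Only the runs and their letters matter here, so the trivial language serves as `L`.
  obtain ⟨u, u', hu, hu', g₁, g₂, -⟩ := h'.exists_words absorbs_univ
  obtain ⟨v, v', hv, hv', g₁', g₂', -⟩ := k.exists_words absorbs_univ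
  have := (h.trans (.loop (x := u ++ (y ++ v)) (y := u' ++ (y' ++ v')) hr hr'
    (by
      simp only [List.toFinset_append, hu, hv]
      exact Finset.union_subset hD (Finset.union_subset hy hD'))
    (by
      simp only [List.toFinset_append, hu', hv']
      exact Finset.union_subset hD (Finset.union_subset hy' hD'))
    (reads_append.2 ⟨_, g₁, reads_append.2 ⟨_, h₁', g₁'⟩⟩)
    (reads_append.2 ⟨_, g₂, reads_append.2 ⟨_, h₂', g₂'⟩⟩))).trans k'
  rwa [Finset.union_eq_right.2 hC, Finset.union_eq_left.2 hC'] at this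

/-- Each refinement cuts off one more piece with letter set `B`: `b v` on the right or `u b` on the
left. Words missing a letter of `B` are covered by the hypothesis on smaller sets. -/
theorem hasPartition_within_framed (hB : B.Nonempty)
    (h : ∀ C ⊂ B, HasPartition (exactly C) (Indist M₁ M₂)) (i j : ℕ) :
    HasPartition (within B) (Framed M₁ M₂ B i j) := by
  have content : ∀ {b : α} {u : List α}, b ∈ B → u.toFinset = B.erase b →
      insert b u.toFinset = B := fun hb hu => by rw [hu, Finset.insert_erase hb]
  induction i with
  | zero =>
    induction j with
    | zero =>
      have e := within_eq_blockStar B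
      rw [e]
      refine .block _ fun u hu v hv => .inr ⟨[], [], u, v, [], [], ⟨rfl, rfl⟩, ⟨rfl, rfl⟩, ?_, ?_,
        by simp, by simp⟩
      · rwa [← e] at hu
      · rwa [← e] at hv
    | succ j ih =>
      refine ih.refine_right hB h (fun _ _ => .inl) ?_
      rintro b hb u u' v v' hv - (hu | ⟨x, x', y, y', z, z', hx, hz, hy, hy', rfl, rfl⟩) hvv
      · exact .inl (hu.append ((indist_singleton b).append hvv))
      · refine .inr ⟨x, x', y, y', _, _, hx,
          hz.snoc ((indist_singleton b).append hvv) ?_, hy, hy', by simp, by simp⟩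
        rw [List.singleton_append, List.toFinset_cons, content hb hv]
  | succ i ih =>
    refine ih.refine_left hB h (fun _ _ => .inl) ?_
    rintro b hb u u' v v' hu - huu (hv | ⟨x, x', y, y', z, z', hx, hz, hy, hy', rfl, rfl⟩)
    · exact .inl (huu.append ((indist_singleton b).append hv))
    · refine .inr ⟨(u ++ [b]) ++ x, (u' ++ [b]) ++ x', y, y', z, z',
        ⟨u ++ [b], u' ++ [b], x, x', huu.append (indist_singleton b), ?_, hx, rfl, rfl⟩,
        hz, hy, hy', by simp, by simp⟩
      rw [List.toFinset_append, Finset.union_comm]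
      exact content hb hu

theorem hasPartition_within_indist [Finite σ₁] [Finite σ₂] (B : Finset α) :
    HasPartition (within B) (Indist M₁ M₂) := by
  induction B using Finset.strongInduction with
  | H B ih =>
    rcases B.eq_empty_or_nonempty with rfl | hB
    · rw [within_eq_blockStar]
      have : ∀ u ∈ blockStar ((∅ : Finset α) : Set α), u = [] := fun u hu =>
        List.eq_nil_iff_forall_not_mem.2 fun x hx => by simpa using hu x hx
      refine .block _ fun u hu v hv => ?_
      rw [this u hu, this v hv]
      refine ⟨rfl, fun s t h₁ h₂ => ?_⟩
      rw [Prod.ext (reads_nil.1 h₁) (reads_nil.1 h₂)]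
      exact .nil t
    · refine (hasPartition_within_framed hB (fun C hC => ?_) _ _).mono
        fun u _ v _ => Framed.indist le_rfl
      -- Indistinguishable words have the same letters, so the partition of `C*` restricts to the
      -- words that use all of `C`.
      have := (ih C hC).inter (Y := exactly C) fun u v h hu => h.1.symm.trans hu
      rwa [Set.inter_eq_right.2] at this
      exact fun w hw => Finset.subset_of_eq hw

/-- The separator is the union of the classes that meet the first language. A word of the second
language in such a class would give a forbidden link. -/
theorem ulSeparable_of_not_linked [Fintype α] [Finite σ₁] [Finite σ₂]
    (h : ∀ B s t, Linked M₁ M₂ B s t → s.1 ∈ M₁.start → s.2 ∈ M₂.start → t.1 ∈ M₁.accept →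
      t.2 ∉ M₂.accept) : ULSeparable M₁.accepts M₂.accepts := by
  obtain ⟨F, h1, h2, h3, h4, h5⟩ :=
    hasPartition_within_indist (M₁ := M₁) (M₂ := M₂) (Finset.univ : Finset α)
  have hG : {L ∈ F | ∃ w ∈ L, w ∈ M₁.accepts}.Finite := h1.subset fun L hL => hL.1
  have := hG.fintype
  let e := (Fintype.equivFin {L ∈ F | ∃ w ∈ L, w ∈ M₁.accepts}).symm
  choose P hP hPe using fun i => unambiguousProduct_iff.1 (h2 (e i) (e i).2.1)
  refine ⟨{w | ∃ i, w ∈ (P i).language}, ⟨_, P, hP, ?_, fun w => Iff.rfl⟩, fun w hw => ?_, ?_⟩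
  · rintro i j hij w ⟨hi, hj⟩
    have hi' : w ∈ (e i : Set (List α)) := hPe i ▸ hi
    have hj' : w ∈ (e j : Set (List α)) := hPe j ▸ hj
    exact hij (e.injective (Subtype.ext (h3.elim (e i).2.1 (e j).2.1
      (Set.not_disjoint_iff.2 ⟨w, hi', hj'⟩))))
  · have hw' : w ∈ ⋃₀ F := h4 ▸ Finset.subset_univ _
    obtain ⟨L, hL, hwL⟩ := hw'
    refine ⟨e.symm ⟨L, hL, w, hwL, hw⟩, ?_⟩
    have := hPe (e.symm ⟨L, hL, w, hwL, hw⟩)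
    rw [e.apply_symm_apply] at this
    exact this ▸ hwL
  · rintro v hv ⟨i, hi⟩
    obtain ⟨hF, u, hu, huM⟩ := (e i).2
    have hv' : v ∈ (e i : Set (List α)) := hPe i ▸ hi
    obtain ⟨p₁, hp₁, q₁, hq₁, r₁⟩ := mem_accepts_iff_reads.1 huM
    obtain ⟨p₂, hp₂, q₂, hq₂, r₂⟩ := mem_accepts_iff_reads.1 hv
    exact h _ _ _ ((h5 _ hF u hu v hv').2 (p₁, p₂) (q₁, q₂) r₁ r₂) hp₁ hp₂ hq₁ hq₂

theorem ulSeparable_iff [Fintype α] [Finite σ₁] [Finite σ₂] :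
    ULSeparable M₁.accepts M₂.accepts ↔
      ¬ ∃ B s t, Linked M₁ M₂ B s t ∧ s.1 ∈ M₁.start ∧ s.2 ∈ M₂.start ∧ t.1 ∈ M₁.accept ∧
        t.2 ∈ M₂.accept := by
  constructor
  · rintro h ⟨B, s, t, hl, h₁, h₂, h₃, h₄⟩
    exact not_ulSeparable_of_linked hl h₁ h₂ h₃ h₄ h
  · intro h
    exact ulSeparable_of_not_linked fun B s t hl h₁ h₂ h₃ h₄ => h ⟨B, s, t, hl, h₁, h₂, h₃, h₄⟩

end UnambiguousSeparation

/-! ### Deducing links by saturation -/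

namespace UnambiguousSeparation

/-- A tuple `(k, B, s, t)` for states `s` and `t` of the product of two automata and a set `B` of
letters. Its meaning depends on the kind `k`, see `Holds`. -/
abbrev Fact : Type := ℕ × List ℕ × (ℕ × ℕ) × ℕ × ℕ

/-- The sorted list of the letters below `m` that occur in `B` or in `C`. -/
def letterUnion (m : ℕ) (B C : List ℕ) : List ℕ := (List.range m).filter fun a => a ∈ B ∨ a ∈ C

/-- The facts that two facts imply. -/
def compose (m : ℕ) (f g : Fact) : List Fact :=
  -- Kind 0 is a link, kind 1 a linked loop at `s` followed by runs over `B` to `t`, kind 2 a bare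
  -- move. The four rules compose links, start kind 1 at a loop, extend it by a move over `B` (the
  -- union being `B` expresses inclusion), and finish the rule `loop` at a loop on `t`.
  (if f.2.2.2 = g.2.2.1 ∧ f.1 = 0 ∧ g.1 = 0 then
    [(0, letterUnion m f.2.1 g.2.1, f.2.2.1, g.2.2.2)] else []) ++
  ((if f.2.2.1 = f.2.2.2 ∧ f.1 = 0 then [(1, f.2)] else []) ++
  ((if f.2.2.2 = g.2.2.1 ∧ f.1 = 1 ∧ g.1 = 2 ∧ letterUnion m f.2.1 g.2.1 = f.2.1 then
    [(1, f.2.1, f.2.2.1, g.2.2.2)] else []) ++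
  (if f.2.2.2 = g.2.2.1 ∧ f.1 = 1 ∧ g.1 = 0 ∧ g.2.2.1 = g.2.2.2 ∧ f.2.1 = g.2.1 then
    [(0, f.2)] else [])))

/-- The transitions of a coded automaton whose numbers are all in range. -/
def transitions (m : ℕ) (c : NFACode) : List (ℕ × ℕ × ℕ) :=
  c.2.2.2.filter fun e => e.1 < c.1 ∧ e.2.1 < m ∧ e.2.2 < c.1

/-- The facts that the transitions of the two automata provide. -/
def baseFacts (x : ℕ × NFACode × NFACode) : List Fact :=
  ((List.range x.2.1.1).flatMap fun p => (List.range x.2.2.1).map fun q =>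
    (0, [], (p, q), (p, q))) ++
  (((transitions x.1 x.2.1).flatMap fun e => (transitions x.1 x.2.2).flatMap fun e' =>
    if e.2.1 = e'.2.1 then [(0, [e.2.1], (e.1, e'.1), (e.2.2, e'.2.2))] else []) ++
  -- A move advances one automaton only, since the two words in `loop` are unrelated and may differ
  -- in length.
  (((transitions x.1 x.2.1).flatMap fun e => (List.range x.2.2.1).map fun q =>
    (2, [e.2.1], (e.1, q), (e.2.2, q))) ++
  ((transitions x.1 x.2.2).flatMap fun e => (List.range x.2.1.1).map fun p =>
    (2, [e.2.1], (p, e.1), (p, e.2.2)))))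

/-- One round of deduction. -/
def saturate (x : ℕ × NFACode × NFACode) (R : List Fact) : List Fact :=
  R ++ (baseFacts x ++ R.flatMap fun f => R.flatMap fun g => compose x.1 f g)

/-- The facts deduced in `n` rounds. -/
def facts (x : ℕ × NFACode × NFACode) (n : ℕ) : List Fact := (saturate x)^[n] []

/-- Some fact of `R` links an initial to a final state. -/
def Refutes (x : ℕ × NFACode × NFACode) (R : List Fact) : Prop :=
  ∃ f ∈ R, f.1 = 0 ∧ f.2.2.1.1 ∈ x.2.1.2.1 ∧ f.2.2.1.2 ∈ x.2.2.2.1 ∧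
    f.2.2.2.1 ∈ x.2.1.2.2.1 ∧ f.2.2.2.2 ∈ x.2.2.2.2.1

/-! ### Primitive recursiveness of the deduction -/

section Primrec

open Primrec

variable {α β : Type*} [Primcodable α] [Primcodable β]

/-- Unbounded search for `n` halts exactly when a witness exists. -/
theorem _root_.REPred.exists_nat {p : α → ℕ → Prop} (hp : PrimrecRel p) :
    REPred fun a => ∃ n, p a n := by
  classical
  have h := Partrec.rfind (p := fun a => ((fun n => decide (p a n) : ℕ → Bool) : ℕ →. Bool))
    hp.decide.to_comp.partrec₂
  refine h.dom_re.of_eq fun a => Nat.rfind_dom.trans ?_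
  constructor
  · rintro ⟨n, hn, -⟩
    exact ⟨n, of_decide_eq_true (Part.mem_some_iff.1 hn).symm⟩
  · rintro ⟨n, hn⟩
    exact ⟨n, Part.mem_some_iff.2 (decide_eq_true hn).symm, fun _ => trivial⟩

theorem primrecPred_mem [DecidableEq β] {f : α → β} {g : α → List β} (hf : Primrec f)
    (hg : Primrec g) : PrimrecPred fun a => f a ∈ g a :=
  ((Primrec.eq (α := β)).exists_mem_list.comp hg hf).of_eq fun a => by simp

theorem primrec_letterUnion {m : α → ℕ} {f g : α → List ℕ} (hm : Primrec m) (hf : Primrec f)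
    (hg : Primrec g) : Primrec fun a => letterUnion (m a) (f a) (g a) := by
  have hR : PrimrecRel fun (b : ℕ) (p : List ℕ × List ℕ) => b ∈ p.1 ∨ b ∈ p.2 :=
    .or (primrecPred_mem fst (fst.comp snd)) (primrecPred_mem fst (snd.comp snd))
  exact hR.listFilter.comp (list_range.comp hm) (hf.pair hg)

theorem primrec_singleton {f : α → β} (hf : Primrec f) : Primrec fun a => [f a] :=
  list_cons.comp hf (const [])

theorem primrec_guard {c : α → Prop} [DecidablePred c] {f : α → β} (hc : PrimrecPred c)
    (hf : Primrec f) : Primrec fun a => if c a then [f a] else [] :=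
  ite hc (primrec_singleton hf) (const [])

theorem primrec_compose : Primrec fun p : ℕ × Fact × Fact => compose p.1 p.2.1 p.2.2 := by
  have f1 : Primrec fun p : ℕ × Fact × Fact => p.2.1.1 := fst.comp (fst.comp snd)
  have f2 : Primrec fun p : ℕ × Fact × Fact => p.2.1.2 := snd.comp (fst.comp snd)
  have fB : Primrec fun p : ℕ × Fact × Fact => p.2.1.2.1 := fst.comp f2
  have fs : Primrec fun p : ℕ × Fact × Fact => p.2.1.2.2.1 := fst.comp (snd.comp f2)
  have ft : Primrec fun p : ℕ × Fact × Fact => p.2.1.2.2.2 := snd.comp (snd.comp f2)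
  have g1 : Primrec fun p : ℕ × Fact × Fact => p.2.2.1 := fst.comp (snd.comp snd)
  have g2 : Primrec fun p : ℕ × Fact × Fact => p.2.2.2 := snd.comp (snd.comp snd)
  have gB : Primrec fun p : ℕ × Fact × Fact => p.2.2.2.1 := fst.comp g2
  have gs : Primrec fun p : ℕ × Fact × Fact => p.2.2.2.2.1 := fst.comp (snd.comp g2)
  have gt : Primrec fun p : ℕ × Fact × Fact => p.2.2.2.2.2 := snd.comp (snd.comp g2)
  have hU : Primrec fun p : ℕ × Fact × Fact => letterUnion p.1 p.2.1.2.1 p.2.2.2.1 :=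
    primrec_letterUnion fst fB gB
  have efg : PrimrecPred fun p : ℕ × Fact × Fact => p.2.1.2.2.2 = p.2.2.2.2.1 :=
    Primrec.eq.comp ft gs
  have ef (k : ℕ) : PrimrecPred fun p : ℕ × Fact × Fact => p.2.1.1 = k :=
    Primrec.eq.comp f1 (const k)
  have eg (k : ℕ) : PrimrecPred fun p : ℕ × Fact × Fact => p.2.2.1 = k :=
    Primrec.eq.comp g1 (const k)
  have h1 := primrec_guard (efg.and ((ef 0).and (eg 0))) ((const 0).pair (hU.pair (fs.pair gt)))
  have h2 := primrec_guard (PrimrecPred.and (Primrec.eq.comp fs ft) (ef 0)) ((const 1).pair f2)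
  have h3 := primrec_guard (efg.and ((ef 1).and ((eg 2).and (Primrec.eq.comp hU fB))))
    ((const 1).pair (fB.pair (fs.pair gt)))
  have h4 := primrec_guard (efg.and ((ef 1).and ((eg 0).and
    (PrimrecPred.and (Primrec.eq.comp gs gt) (Primrec.eq.comp fB gB))))) ((const 0).pair f2)
  exact list_append.comp h1 (list_append.comp h2 (list_append.comp h3 h4))

theorem primrec_transitions : Primrec₂ transitions := by
  have hR : PrimrecRel fun (e : ℕ × ℕ × ℕ) (y : ℕ × NFACode) =>
      e.1 < y.2.1 ∧ e.2.1 < y.1 ∧ e.2.2 < y.2.1 :=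
    .and (nat_lt.comp (fst.comp fst) (fst.comp (snd.comp snd)))
      (.and (nat_lt.comp (fst.comp (snd.comp fst)) (fst.comp snd))
        (nat_lt.comp (snd.comp (snd.comp fst)) (fst.comp (snd.comp snd))))
  exact hR.listFilter.comp (snd.comp (snd.comp (snd.comp snd))) Primrec.id

theorem primrec_baseFacts : Primrec baseFacts := by
  have t1 : Primrec fun x : ℕ × NFACode × NFACode => transitions x.1 x.2.1 :=
    primrec_transitions.comp fst (fst.comp snd)
  have t2 : Primrec fun x : ℕ × NFACode × NFACode => transitions x.1 x.2.2 :=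
    primrec_transitions.comp fst (snd.comp snd)
  have r1 : Primrec fun x : ℕ × NFACode × NFACode => List.range x.2.1.1 :=
    list_range.comp (fst.comp (fst.comp snd))
  have r2 : Primrec fun x : ℕ × NFACode × NFACode => List.range x.2.2.1 :=
    list_range.comp (fst.comp (snd.comp snd))
  have e1 : Primrec fun e : ℕ × ℕ × ℕ => e.1 := fst
  have e2 : Primrec fun e : ℕ × ℕ × ℕ => e.2.1 := fst.comp snd
  have e3 : Primrec fun e : ℕ × ℕ × ℕ => e.2.2 := snd.comp snd
  have h1 : Primrec₂ fun p q : ℕ => ((0, [], (p, q), (p, q)) : Fact) :=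
    (const 0).pair ((const []).pair (Primrec.id.pair Primrec.id))
  have h2 : Primrec₂ fun e e' : ℕ × ℕ × ℕ => if e.2.1 = e'.2.1 then
      [((0, [e.2.1], (e.1, e'.1), (e.2.2, e'.2.2)) : Fact)] else [] :=
    primrec_guard (Primrec.eq.comp (e2.comp fst) (e2.comp snd))
      ((const 0).pair ((primrec_singleton (e2.comp fst)).pair
        (((e1.comp fst).pair (e1.comp snd)).pair ((e3.comp fst).pair (e3.comp snd)))))
  have h3 : Primrec₂ fun (e : ℕ × ℕ × ℕ) (q : ℕ) =>
      ((2, [e.2.1], (e.1, q), (e.2.2, q)) : Fact) :=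
    (const 2).pair ((primrec_singleton (e2.comp fst)).pair
      (((e1.comp fst).pair snd).pair ((e3.comp fst).pair snd)))
  have h4 : Primrec₂ fun (e : ℕ × ℕ × ℕ) (p : ℕ) =>
      ((2, [e.2.1], (p, e.1), (p, e.2.2)) : Fact) :=
    (const 2).pair ((primrec_singleton (e2.comp fst)).pair
      ((snd.pair (e1.comp fst)).pair (snd.pair (e3.comp fst))))
  have k1 := list_flatMap r1 (list_map (r2.comp fst) (h1.comp (snd.comp fst) snd).to₂).to₂
  have k2 := list_flatMap t1 (list_flatMap (t2.comp fst) (h2.comp (snd.comp fst) snd).to₂).to₂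
  have k3 := list_flatMap t1 (list_map (r2.comp fst) (h3.comp (snd.comp fst) snd).to₂).to₂
  have k4 := list_flatMap t2 (list_map (r1.comp fst) (h4.comp (snd.comp fst) snd).to₂).to₂
  exact list_append.comp k1 (list_append.comp k2 (list_append.comp k3 k4))

theorem primrec_saturate : Primrec₂ saturate := by
  have h := primrec_compose.comp (α := ((((ℕ × NFACode × NFACode) × List Fact) × Fact) × Fact))
    ((fst.comp (fst.comp (fst.comp fst))).pair ((snd.comp fst).pair snd))
  have h' := list_flatMap (α := ((ℕ × NFACode × NFACode) × List Fact) × Fact)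
    (snd.comp fst) h.to₂
  have h'' := list_flatMap (α := (ℕ × NFACode × NFACode) × List Fact) snd h'.to₂
  exact list_append.comp snd (list_append.comp (primrec_baseFacts.comp fst) h'')

theorem primrec_facts : Primrec₂ facts :=
  nat_iterate snd (const []) (primrec_saturate.comp (fst.comp fst) snd)

theorem primrecRel_refutes : PrimrecRel Refutes := by
  have hR : PrimrecRel fun (f : Fact) (x : ℕ × NFACode × NFACode) =>
      f.1 = 0 ∧ f.2.2.1.1 ∈ x.2.1.2.1 ∧ f.2.2.1.2 ∈ x.2.2.2.1 ∧
        f.2.2.2.1 ∈ x.2.1.2.2.1 ∧ f.2.2.2.2 ∈ x.2.2.2.2.1 := by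
    have s : Primrec fun p : Fact × ℕ × NFACode × NFACode => p.1.2.2.1 :=
      fst.comp (snd.comp (snd.comp fst))
    have t : Primrec fun p : Fact × ℕ × NFACode × NFACode => p.1.2.2.2 :=
      snd.comp (snd.comp (snd.comp fst))
    have c1 : Primrec fun p : Fact × ℕ × NFACode × NFACode => p.2.2.1.2 :=
      snd.comp (fst.comp (snd.comp snd))
    have c2 : Primrec fun p : Fact × ℕ × NFACode × NFACode => p.2.2.2.2 :=
      snd.comp (snd.comp (snd.comp snd))
    exact .and (Primrec.eq.comp (fst.comp fst) (const 0)) (.and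
      (primrecPred_mem (fst.comp s) (fst.comp c1)) (.and
      (primrecPred_mem (snd.comp s) (fst.comp c2)) (.and
      (primrecPred_mem (fst.comp t) (fst.comp (snd.comp c1)))
      (primrecPred_mem (snd.comp t) (fst.comp (snd.comp c2))))))
  exact hR.exists_mem_list.comp snd fst

theorem primrecRel_closed : PrimrecRel fun (x : ℕ × NFACode × NFACode) (R : List Fact) =>
    ∀ f ∈ saturate x R, f ∈ R := by
  have hR : PrimrecRel fun (f : Fact) (R : List Fact) => f ∈ R := primrecPred_mem fst snd
  exact hR.forall_mem_list.comp primrec_saturate snd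

end Primrec

/-! ### Correctness and termination of the deduction -/

section Deduction

variable {x : ℕ × NFACode × NFACode}

theorem mem_saturate {R : List Fact} {h : Fact} :
    h ∈ saturate x R ↔ h ∈ R ∨ h ∈ baseFacts x ∨ ∃ f ∈ R, ∃ g ∈ R, h ∈ compose x.1 f g := by
  simp [saturate]

theorem facts_succ (n : ℕ) : facts x (n + 1) = saturate x (facts x n) :=
  Function.iterate_succ_apply' _ _ _

theorem facts_mono {m n : ℕ} (h : m ≤ n) : facts x m ⊆ facts x n := by
  induction h with
  | refl => exact List.Subset.refl _
  | step _ ih =>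
    intro f hf
    rw [facts_succ]
    exact mem_saturate.2 (.inl (ih hf))

theorem facts_subset_of_closed {R : List Fact} (hR : ∀ f ∈ saturate x R, f ∈ R) (n : ℕ) :
    facts x n ⊆ R := by
  induction n with
  | zero => exact List.nil_subset _
  | succ n ih =>
    intro h hh
    rw [facts_succ, mem_saturate] at hh
    refine hR h (mem_saturate.2 ?_)
    rcases hh with hh | hh | ⟨f, hf, g, hg, hh⟩
    · exact .inl (ih hh)
    · exact .inr (.inl hh)
    · exact .inr (.inr ⟨f, ih hf, g, ih hg, hh⟩)

variable (x) in
/-- The fact `f` is deduced in some round. -/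
def Derived (f : Fact) : Prop := ∃ n, f ∈ facts x n

theorem derived_of_mem_baseFacts {f : Fact} (h : f ∈ baseFacts x) : Derived x f :=
  ⟨1, by rw [facts_succ]; exact mem_saturate.2 (.inr (.inl h))⟩

theorem Derived.compose {f g h : Fact} (hf : Derived x f) (hg : Derived x g)
    (hh : h ∈ compose x.1 f g) : Derived x h := by
  obtain ⟨m, hm⟩ := hf
  obtain ⟨n, hn⟩ := hg
  refine ⟨max m n + 1, ?_⟩
  rw [facts_succ]
  exact mem_saturate.2 (.inr (.inr ⟨f, facts_mono (le_max_left _ _) hm, g,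
    facts_mono (le_max_right _ _) hn, hh⟩))

theorem mem_transitions {m : ℕ} {c : NFACode} {e : ℕ × ℕ × ℕ} :
    e ∈ transitions m c ↔ ∃ (p q : Fin c.1) (a : Fin m), e = ((p : ℕ), (a : ℕ), (q : ℕ)) ∧
      q ∈ (c.toNFA m).step p a := by
  obtain ⟨p, a, q⟩ := e
  simp only [transitions, List.mem_filter, decide_eq_true_eq, NFACode.toNFA, Set.mem_ofPred_eq]
  constructor
  · rintro ⟨h, hp, ha, hq⟩
    exact ⟨⟨p, hp⟩, ⟨q, hq⟩, ⟨a, ha⟩, rfl, h⟩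
  · rintro ⟨p', q', a', e, h⟩
    simp only [Prod.mk.injEq] at e
    obtain ⟨rfl, rfl, rfl⟩ := e
    exact ⟨h, p'.2, a'.2, q'.2⟩

/-- The sorted list of the letters of `B`. -/
def letterCode {m : ℕ} (B : Finset (Fin m)) : List ℕ :=
  (List.range m).filter fun a => ∃ b ∈ B, (b : ℕ) = a

theorem val_mem_letterCode {m : ℕ} {B : Finset (Fin m)} {a : Fin m} :
    (a : ℕ) ∈ letterCode B ↔ a ∈ B := by
  simp [letterCode, Fin.val_inj]

/-- Codes are canonical, so the list equalities tested in `compose` are equalities of letter sets.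
-/
theorem letterCode_injective {m : ℕ} : Function.Injective (letterCode (m := m)) := by
  intro B C h
  ext a
  rw [← val_mem_letterCode, h, val_mem_letterCode]

theorem letterUnion_letterCode {m : ℕ} (B C : Finset (Fin m)) :
    letterUnion m (letterCode B) (letterCode C) = letterCode (B ∪ C) := by
  refine List.filter_congr fun a ha => decide_eq_decide.2 ?_
  lift a to Fin m using List.mem_range.1 ha
  rw [val_mem_letterCode, val_mem_letterCode]
  simp [Fin.val_inj]

theorem letterCode_empty {m : ℕ} : letterCode (∅ : Finset (Fin m)) = [] := by
  simp [letterCode]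

theorem letterCode_singleton {m : ℕ} (a : Fin m) : letterCode {a} = [(a : ℕ)] := by
  have : letterCode {a} = (List.range m).filter fun b => b = (a : ℕ) := by
    simp [letterCode, eq_comm]
  rw [this, List.filter_eq, List.count_eq_one_of_mem List.nodup_range (List.mem_range.2 a.2)]
  rfl

variable (x) in
/-- The states of the product of the two automata. -/
abbrev PairState : Type := Fin x.2.1.1 × Fin x.2.2.1

variable (x) in
/-- The fact `(k, B, s, t)`. -/
def mkFact (k : ℕ) (B : Finset (Fin x.1)) (s t : PairState x) : Fact :=
  (k, letterCode B, ((s.1 : ℕ), (s.2 : ℕ)), ((t.1 : ℕ), (t.2 : ℕ)))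

variable (x) in
/-- In both automata, some word of `B*` leads from `s` to `t`. -/
def Reachable (B : Finset (Fin x.1)) (s t : PairState x) : Prop :=
  ∃ u v : List (Fin x.1), u.toFinset ⊆ B ∧ v.toFinset ⊆ B ∧
    Reads (x.2.1.toNFA x.1) s.1 u t.1 ∧ Reads (x.2.2.toNFA x.1) s.2 v t.2

variable (x) in
/-- The meaning of the fact `(k, B, s, t)`. -/
def Meaning (k : ℕ) (B : Finset (Fin x.1)) (s t : PairState x) : Prop :=
  k = 0 ∧ Linked (x.2.1.toNFA x.1) (x.2.2.toNFA x.1) B s t ∨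
  k = 1 ∧ Linked (x.2.1.toNFA x.1) (x.2.2.toNFA x.1) B s s ∧ Reachable x B s t ∨
  k = 2 ∧ Reachable x B s t

variable (x) in
/-- The fact is well-formed and true. -/
def Holds (f : Fact) : Prop := ∃ k B s t, f = mkFact x k B s t ∧ Meaning x k B s t

theorem Reachable.refl (B : Finset (Fin x.1)) (s : PairState x) : Reachable x B s s :=
  ⟨[], [], by simp, by simp, reads_nil.2 rfl, reads_nil.2 rfl⟩

theorem Reachable.trans {B C : Finset (Fin x.1)} {s t r : PairState x} (h : Reachable x B s t)
    (h' : Reachable x C t r) : Reachable x (B ∪ C) s r := by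
  obtain ⟨u, v, hu, hv, h₁, h₂⟩ := h
  obtain ⟨u', v', hu', hv', h₁', h₂'⟩ := h'
  refine ⟨u ++ u', v ++ v', ?_, ?_, reads_append.2 ⟨_, h₁, h₁'⟩, reads_append.2 ⟨_, h₂, h₂'⟩⟩
  · rw [List.toFinset_append]
    exact Finset.union_subset_union hu hu'
  · rw [List.toFinset_append]
    exact Finset.union_subset_union hv hv'

theorem holds_of_mem_baseFacts {f : Fact} (h : f ∈ baseFacts x) : Holds x f := by
  simp only [baseFacts, List.mem_append, List.mem_flatMap, List.mem_map, List.mem_range] at h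
  rcases h with ⟨p, hp, q, hq, rfl⟩ | ⟨e, he, e', he', h⟩ | ⟨e, he, q, hq, rfl⟩ |
    ⟨e, he, q, hq, rfl⟩
  · refine ⟨0, ∅, (⟨p, hp⟩, ⟨q, hq⟩), (⟨p, hp⟩, ⟨q, hq⟩), ?_, .inl ⟨rfl, .nil _⟩⟩
    simp [mkFact, letterCode_empty]
  · obtain ⟨p, q, a, rfl, hpq⟩ := mem_transitions.1 he
    obtain ⟨p', q', a', rfl, hpq'⟩ := mem_transitions.1 he'
    split_ifs at h with haa
    · obtain rfl : a = a' := Fin.val_injective haa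
      refine ⟨0, {a}, (p, p'), (q, q'), ?_, .inl ⟨rfl, .letter hpq hpq'⟩⟩
      simpa [mkFact, letterCode_singleton] using h
    · simp at h
  · obtain ⟨p, p', a, rfl, hpq⟩ := mem_transitions.1 he
    refine ⟨2, {a}, (p, ⟨q, hq⟩), (p', ⟨q, hq⟩), by simp [mkFact, letterCode_singleton],
      .inr (.inr ⟨rfl, [a], [], by simp, by simp, reads_singleton.2 hpq, reads_nil.2 rfl⟩)⟩
  · obtain ⟨p, p', a, rfl, hpq⟩ := mem_transitions.1 he
    refine ⟨2, {a}, (⟨q, hq⟩, p), (⟨q, hq⟩, p'), by simp [mkFact, letterCode_singleton],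
      .inr (.inr ⟨rfl, [], [a], by simp, by simp, reads_nil.2 rfl, reads_singleton.2 hpq⟩)⟩

theorem Holds.compose {f g h : Fact} (hf : Holds x f) (hg : Holds x g)
    (hh : h ∈ compose x.1 f g) : Holds x h := by
  obtain ⟨k, B, s, t, rfl, hm⟩ := hf
  obtain ⟨l, C, s', t', rfl, hm'⟩ := hg
  have inj {s t : PairState x}
      (h : (((s.1 : ℕ), (s.2 : ℕ)) : ℕ × ℕ) = ((t.1 : ℕ), (t.2 : ℕ))) : s = t := by
    simp only [Prod.mk.injEq, Fin.val_inj] at h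
    exact Prod.ext h.1 h.2
  simp only [UnambiguousSeparation.compose, List.mem_append, List.mem_ite_nil_right,
    List.mem_singleton] at hh
  simp only [mkFact, letterUnion_letterCode] at hh
  rcases hh with ⟨⟨h1, rfl, rfl⟩, rfl⟩ | ⟨⟨h1, rfl⟩, rfl⟩ | ⟨⟨h1, rfl, rfl, h2⟩, rfl⟩ |
    ⟨⟨h1, rfl, rfl, h2, h3⟩, rfl⟩
  · obtain rfl := inj h1
    simp only [Meaning, zero_ne_one, OfNat.zero_ne_ofNat, false_and, or_false, true_and] at hm hm'
    exact ⟨0, B ∪ C, s, t', rfl, .inl ⟨rfl, hm.trans hm'⟩⟩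
  · obtain rfl := inj h1
    simp only [Meaning, zero_ne_one, OfNat.zero_ne_ofNat, false_and, or_false, true_and] at hm
    exact ⟨1, B, s, s, rfl, .inr (.inl ⟨rfl, hm, .refl _ _⟩)⟩
  · obtain rfl := inj h1
    have h2 := letterCode_injective h2
    simp only [Meaning, one_ne_zero, OfNat.one_ne_ofNat, OfNat.ofNat_ne_zero,
      OfNat.ofNat_ne_one, false_and, or_false, false_or, true_and] at hm hm'
    exact ⟨1, B, s, t', rfl, .inr (.inl ⟨rfl, hm.1, h2 ▸ hm.2.trans hm'⟩)⟩
  · obtain rfl := inj h1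
    obtain rfl := inj h2
    obtain rfl := letterCode_injective h3
    simp only [Meaning, one_ne_zero, zero_ne_one, OfNat.one_ne_ofNat, OfNat.zero_ne_ofNat,
      false_and, or_false, false_or, true_and] at hm hm'
    obtain ⟨hs, u, v, hu, hv, h₁, h₂⟩ := hm
    exact ⟨0, B, s, t, rfl, .inl ⟨rfl, .loop hs hm' hu hv h₁ h₂⟩⟩

theorem Derived.holds {f : Fact} (h : Derived x f) : Holds x f := by
  obtain ⟨n, hn⟩ := h
  induction n generalizing f with
  | zero => exact absurd hn List.not_mem_nil
  | succ n ih =>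
    rw [facts_succ, mem_saturate] at hn
    rcases hn with h | h | ⟨f, hf, g, hg, h⟩
    · exact ih h
    · exact holds_of_mem_baseFacts h
    · exact (ih hf).compose (ih hg) h

theorem Derived.step {B C : Finset (Fin x.1)} {s t r : PairState x}
    (h : Derived x (mkFact x 1 B s t)) (h' : Derived x (mkFact x 2 C t r)) (hC : C ⊆ B) :
    Derived x (mkFact x 1 B s r) := by
  refine h.compose h' ?_
  simp [UnambiguousSeparation.compose, mkFact, letterUnion_letterCode, Finset.union_eq_left.2 hC]

theorem Derived.reads_left {B : Finset (Fin x.1)} {s : PairState x} {u : List (Fin x.1)}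
    {p q : Fin x.2.1.1} {r : Fin x.2.2.1} (h : Derived x (mkFact x 1 B s (p, r)))
    (hu : u.toFinset ⊆ B) (hr : Reads (x.2.1.toNFA x.1) p u q) :
    Derived x (mkFact x 1 B s (q, r)) := by
  induction u generalizing p with
  | nil => exact reads_nil.1 hr ▸ h
  | cons a u ih =>
    obtain ⟨p', hp', hr⟩ := reads_cons.1 hr
    rw [List.toFinset_cons, Finset.insert_subset_iff] at hu
    refine ih (h.step (C := {a}) (derived_of_mem_baseFacts ?_)
      (Finset.singleton_subset_iff.2 hu.1)) hu.2 hr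
    simp only [baseFacts, List.mem_append, List.mem_flatMap, List.mem_map, List.mem_range]
    refine .inr (.inr (.inl ⟨_, mem_transitions.2 ⟨p, p', a, rfl, hp'⟩, r, r.2, ?_⟩))
    simp [mkFact, letterCode_singleton]

theorem Derived.reads_right {B : Finset (Fin x.1)} {s : PairState x} {u : List (Fin x.1)}
    {p q : Fin x.2.2.1} {r : Fin x.2.1.1} (h : Derived x (mkFact x 1 B s (r, p)))
    (hu : u.toFinset ⊆ B) (hr : Reads (x.2.2.toNFA x.1) p u q) :
    Derived x (mkFact x 1 B s (r, q)) := by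
  induction u generalizing p with
  | nil => exact reads_nil.1 hr ▸ h
  | cons a u ih =>
    obtain ⟨p', hp', hr⟩ := reads_cons.1 hr
    rw [List.toFinset_cons, Finset.insert_subset_iff] at hu
    refine ih (h.step (C := {a}) (derived_of_mem_baseFacts ?_)
      (Finset.singleton_subset_iff.2 hu.1)) hu.2 hr
    simp only [baseFacts, List.mem_append, List.mem_flatMap, List.mem_map, List.mem_range]
    refine .inr (.inr (.inr ⟨_, mem_transitions.2 ⟨p, p', a, rfl, hp'⟩, r, r.2, ?_⟩))
    simp [mkFact, letterCode_singleton]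

theorem Linked.derived {B : Finset (Fin x.1)} {s t : PairState x}
    (h : Linked (x.2.1.toNFA x.1) (x.2.2.toNFA x.1) B s t) : Derived x (mkFact x 0 B s t) := by
  induction h with
  | nil s =>
    refine derived_of_mem_baseFacts ?_
    simp only [baseFacts, List.mem_append, List.mem_flatMap, List.mem_map, List.mem_range]
    refine .inl ⟨s.1, s.1.2, s.2, s.2.2, ?_⟩
    simp [mkFact, letterCode_empty]
  | @letter s t a h₁ h₂ =>
    refine derived_of_mem_baseFacts ?_
    simp only [baseFacts, List.mem_append, List.mem_flatMap, List.mem_map, List.mem_range]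
    refine .inr (.inl ⟨_, mem_transitions.2 ⟨_, _, a, rfl, h₁⟩, _,
      mem_transitions.2 ⟨_, _, a, rfl, h₂⟩, ?_⟩)
    simp [mkFact, letterCode_singleton]
  | trans _ _ ih ih' =>
    refine ih.compose ih' ?_
    simp [UnambiguousSeparation.compose, mkFact, letterUnion_letterCode]
  | @loop B s t u v _ _ hu hv h₁ h₂ ih ih' =>
    have h0 : Derived x (mkFact x 1 B s s) := by
      refine ih.compose ih ?_
      simp [UnambiguousSeparation.compose, mkFact]
    -- The first automaton reads `u` while the second waits, then the roles are exchanged.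
    have h1 : Derived x (mkFact x 1 B s t) :=
      (h0.reads_left (p := s.1) (r := s.2) hu h₁).reads_right hv h₂
    refine h1.compose ih' ?_
    simp [UnambiguousSeparation.compose, mkFact]

variable (x) in
-- Derived facts are well-formed, hence finite in number, and the rounds increase.
theorem exists_forall_derived_mem_facts : ∃ n, ∀ f, Derived x f → f ∈ facts x n := by
  have hfin : {f | Derived x f}.Finite := by
    refine (Set.finite_range fun y : Fin 3 × Finset (Fin x.1) × PairState x × PairState x =>
      mkFact x y.1 y.2.1 y.2.2.1 y.2.2.2).subset fun f hf => ?_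
    obtain ⟨k, B, s, t, rfl, h⟩ := Derived.holds hf
    rcases h with ⟨rfl, -⟩ | ⟨rfl, -⟩ | ⟨rfl, -⟩
    · exact ⟨(0, B, s, t), rfl⟩
    · exact ⟨(1, B, s, t), rfl⟩
    · exact ⟨(2, B, s, t), rfl⟩
  have : ∀ f : {f | Derived x f}, ∃ n, (f : Fact) ∈ facts x n := fun f => f.2
  choose n hn using this
  have := hfin.fintype
  exact ⟨Finset.univ.sup n, fun f hf =>
    facts_mono (Finset.le_sup (f := n) (Finset.mem_univ ⟨f, hf⟩)) (hn ⟨f, hf⟩)⟩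

theorem not_ulSeparable_iff :
    ¬ ULSeparable (NFACode.language x.1 x.2.1) (NFACode.language x.1 x.2.2) ↔
      ∃ n, Refutes x (facts x n) := by
  unfold NFACode.language
  rw [ulSeparable_iff, not_not]
  constructor
  · rintro ⟨B, s, t, h, hs₁, hs₂, ht₁, ht₂⟩
    obtain ⟨n, hn⟩ := h.derived
    exact ⟨n, _, hn, rfl, hs₁, hs₂, ht₁, ht₂⟩
  · rintro ⟨n, f, hf, hk, hs₁, hs₂, ht₁, ht₂⟩
    obtain ⟨k, B, s, t, rfl, hm⟩ := Derived.holds ⟨n, hf⟩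
    obtain rfl : k = 0 := hk
    simp only [Meaning, zero_ne_one, OfNat.zero_ne_ofNat, false_and, or_false, true_and] at hm
    exact ⟨B, s, t, hm, hs₁, hs₂, ht₁, ht₂⟩

/-- A closed round contains all later rounds, so a closed round without a refutation certifies
separability; by finiteness a closed round exists. -/
theorem ulSeparable_iff_exists_closed :
    ULSeparable (NFACode.language x.1 x.2.1) (NFACode.language x.1 x.2.2) ↔
      ∃ n, (∀ f ∈ saturate x (facts x n), f ∈ facts x n) ∧ ¬ Refutes x (facts x n) := by
  rw [← not_iff_not, not_ulSeparable_iff]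
  constructor
  · rintro ⟨m, f, hf, h⟩ ⟨n, hn, hn'⟩
    exact hn' ⟨f, facts_subset_of_closed hn m hf, h⟩
  · intro h
    obtain ⟨n, hn⟩ := exists_forall_derived_mem_facts x
    by_contra h'
    exact h ⟨n, fun f hf => hn f ⟨n + 1, by rwa [facts_succ]⟩, fun hr => h' ⟨n, hr⟩⟩

end Deduction

end UnambiguousSeparation

/-- There is an algorithm that, given an alphabet size `m` and two nondeterministic finite automata
over the alphabet with `m` letters, decides whether the languages that they accept can be
separated by an unambiguous language. -/
theorem corollary5 :
    ComputablePred fun x : ℕ × NFACode × NFACode =>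
      ULSeparable (NFACode.language x.1 x.2.1) (NFACode.language x.1 x.2.2) := by
  open UnambiguousSeparation in
  have hr : PrimrecRel fun x n => Refutes x (facts x n) :=
    primrecRel_refutes.comp Primrec.fst primrec_facts
  have hc : PrimrecRel fun x n => ∀ f ∈ saturate x (facts x n), f ∈ facts x n :=
    primrecRel_closed.comp Primrec.fst primrec_facts
  -- By Post's theorem, two semi-decision procedures suffice.
  refine ComputablePred.computable_iff_re_compl_re'.2 ⟨?_, ?_⟩
  · exact (REPred.exists_nat (PrimrecPred.primrecRel (hc.and hr.not))).of_eq fun x => ulSeparable_iff_exists_closed.symm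
  · exact (REPred.exists_nat hr).of_eq fun x => not_ulSeparable_iff.symm
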